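/- **Setting.** Let $d,m\ge 1$ and $n\ge 0$ be integers, let $x_1,\dots,x_n\in\mathbb R^d$ satisfy $\|x_i\|=\sqrt d$ with no two of them parallel (linearly dependent), let $y_1,\dots,y_n\in\mathbb R$ satisfy $|y_i|\le C_y$ with $C_y\ge 1$, and write $\tilde x=(x,1)\in\mathbb R^{d+1}$, $\sigma(z)=\max(0,z)$, $Y=(y_1,\dots,y_n)^T$. For $w=(w_1,\dots,w_m)\in\mathbb R^{m(d+1)}$ and signs $a_1,\dots,a_m$ let $$f(x,w)=\sum_{k=1}^m\frac{a_k}{\sqrt m}\,\sigma(w_k^T\tilde x),\qquad \nabla f(x,w)=\Big(\frac{a_k}{\sqrt m}\,\sigma'(w_k^T\tilde x)\,\tilde x\Big)_{k=1}^m,\qquad \sigma'(z)=\mathbf 1_{z\ge 0}.$$ At initialization all the $w_k(0)\sim\mathcal N(0,I_{d+1})$ (that is, $\kappa=1$) and all the $a_k$, uniform on $\{1,-1\}$, are independent. Let $\nabla f_0=[\nabla f(x_1,w(0)),\dots,\nabla f(x_n,w(0))]$ and $H=\mathbb E[\nabla^Tf_0\,\nabla f_0]\in\mathbb R^{n\times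 n}$. Let $$w_L^*=\arg\min_w\|w-w(0)\|\quad\text{subject to}\quad f(x_i,w(0))+\nabla f(x_i,w(0))^T(w-w(0))=y_i,\quad i=1,\dots,n.$$ A gradient flow $\dot w=-\nabla f\,(f-Y)$ started at $w(0)$ is a locally absolutely continuous $w:[0,\infty)\to\mathbb R^{m(d+1)}$ such that for almost every $t$ $$\dot w_k(t)=-\sum_{i=1}^n\big(f(x_i,w(t))-y_i\big)\frac{a_k}{\sqrt m}\,s_{ik}\,\tilde x_i\qquad(k=1,\dots,m)$$ for some $s_{ik}\in[0,1]$ with $s_{ik}=1$ if $w_k(t)^T\tilde x_i>0$ and $s_{ik}=0$ if $w_k(t)^T\tilde x_i<0$ (so every convention for $\sigma'(0)$ in $[0,1]$ is covered). **Theorem.** There are universal constants $C_1,C_2>0$ such that, in the setting above, $H$ is positive definite, and for all $c>0$ with $H\succeq cI$ and all $\delta\in(0,1)$: if $$m\ \ge\ C_1\,\frac{n^6d^4C_y^2}{c^4\delta^3},$$ then with probability greater than $1-\delta$ over the initialization, $w_L^*$ exists and every gradient flow $w$ started at $w(0)$ satisfies, for all $t\ge 0$, $$\|w(t)-w_L^*\|\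 \le\ e^{-ct/2}\,\|w(0)-w_L^*\|+C_2\,\frac{(dn)^{5/2}\,C_y^{3/2}}{c^{5/2}\,\delta^{3/2}\,m^{1/4}}.$$ -/

import Mathlib

open MeasureTheory ProbabilityTheory
open scoped InnerProductSpace

noncomputable section

namespace ShallowReLU

/-- The parameter space `ℝ^{m(d+1)}` with its Euclidean norm; the coordinate `(k, j)` is the `j`-th
weight of the neuron `k`, and the last one of each neuron is its bias. -/
abbrev Weights (m d : ℕ) : Type := EuclideanSpace ℝ (Fin m × Fin (d + 1))

/-- The weight vector `wₖ ∈ ℝ^{d+1}` of the neuron `k`. -/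
def neuron {m d : ℕ} (w : Weights m d) (k : Fin m) : EuclideanSpace ℝ (Fin (d + 1)) :=
  WithLp.toLp 2 (fun j => w (k, j))

/-- The point of `ℝ^{m(d+1)}` with neurons `v₁, …, v_m`. -/
def assemble {m d : ℕ} (v : Fin m → EuclideanSpace ℝ (Fin (d + 1))) : Weights m d :=
  WithLp.toLp 2 (fun q => v q.1 q.2)

/-- The input with a constant coordinate appended, `x̃ = (x, 1)`. -/
def augment {d : ℕ} (x : EuclideanSpace ℝ (Fin d)) : EuclideanSpace ℝ (Fin (d + 1)) :=
  WithLp.toLp 2 (Fin.snoc (α := fun _ => ℝ) (fun j => x j) 1)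

/-- The ReLU activation `σ(z) = max(0, z)`. -/
def relu (z : ℝ) : ℝ := max 0 z

/-- The derivative of ReLU with the convention `σ'(0) = 1`, i.e. the indicator of `z ≥ 0`. -/
def reluDeriv (z : ℝ) : ℝ := if 0 ≤ z then 1 else 0

/-- The set of admissible values of `σ'(z)`: the derivative if `z ≠ 0`, and all of `[0, 1]`
(the Clarke subdifferential) at the kink `z = 0`. -/
def reluSubderiv (z : ℝ) : Set ℝ := {s | (0 < z → s = 1) ∧ (z < 0 → s = 0) ∧ 0 ≤ s ∧ s ≤ 1}

/-- The network `f(x, w) = ∑ₖ (aₖ / √m) σ(wₖᵀ x̃)`. -/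
def net {m d : ℕ} (a : Fin m → ℝ) (x : EuclideanSpace ℝ (Fin d)) (w : Weights m d) : ℝ :=
  ∑ k, a k / Real.sqrt m * relu ⟪neuron w k, augment x⟫_ℝ

/-- The vector of `ℝ^{m(d+1)}` with blocks `(aₖ / √m) sₖ x̃`. For `sₖ = σ'(wₖᵀ x̃)` this is the
gradient of the network in the weights. -/
def gradWith {m d : ℕ} (a : Fin m → ℝ) (x : EuclideanSpace ℝ (Fin d)) (s : Fin m → ℝ) :
    Weights m d :=
  assemble (fun k => (a k / Real.sqrt m * s k) • augment x)

/-- The gradient `∇f(x, w)` of the network in the weights. -/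
def netGrad {m d : ℕ} (a : Fin m → ℝ) (x : EuclideanSpace ℝ (Fin d)) (w : Weights m d) :
    Weights m d :=
  gradWith a x (fun k => reluDeriv ⟪neuron w k, augment x⟫_ℝ)

/-- The linearization `f_L(x, w) = f(x, w(0)) + ∇f(x, w(0))ᵀ (w - w(0))` at `w(0) = w₀`. -/
def netLin {m d : ℕ} (a : Fin m → ℝ) (w₀ : Weights m d) (x : EuclideanSpace ℝ (Fin d))
    (w : Weights m d) : ℝ :=
  net a x w₀ + ⟪netGrad a x w₀, w - w₀⟫_ℝ

/-- `wL` is `w_L^*`: it minimizes `‖w - w₀‖` among all `w` with `f_L(xᵢ, w) = yᵢ` for all `i`. -/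
def IsMinNormInterpolant {m d n : ℕ} (a : Fin m → ℝ) (w₀ : Weights m d)
    (x : Fin n → EuclideanSpace ℝ (Fin d)) (y : Fin n → ℝ) (wL : Weights m d) : Prop :=
  (∀ i, netLin a w₀ (x i) wL = y i) ∧
    ∀ w : Weights m d, (∀ i, netLin a w₀ (x i) w = y i) → ‖wL - w₀‖ ≤ ‖w - w₀‖

/-- The admissible values of `-∇f (f - Y)` at `w`, with `σ'` replaced by any admissible value at
a kink. Away from the kinks this is the single vector `-∑ᵢ (f(xᵢ, w) - yᵢ) ∇f(xᵢ, w)`; for any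
convention for `σ'(0)` in `[0, 1]` the corresponding vector belongs to the set. -/
def flowField {m d n : ℕ} (a : Fin m → ℝ) (x : Fin n → EuclideanSpace ℝ (Fin d))
    (y : Fin n → ℝ) (w : Weights m d) : Set (Weights m d) :=
  {v | ∃ s : Fin n → Fin m → ℝ, (∀ i k, s i k ∈ reluSubderiv ⟪neuron w k, augment (x i)⟫_ℝ) ∧
    v = -∑ i, (net a (x i) w - y i) • gradWith a (x i) (s i)}

/-- `w` is a gradient flow `ẇ = -∇f (f - Y)` on `[0, ∞)` started at `w₀`: it is locally absolutely
continuous and satisfies the equation at almost every time. -/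
def IsGradientFlow {m d n : ℕ} (a : Fin m → ℝ) (x : Fin n → EuclideanSpace ℝ (Fin d))
    (y : Fin n → ℝ) (w₀ : Weights m d) (w : ℝ → Weights m d) : Prop :=
  w 0 = w₀ ∧ (∀ T : ℝ, 0 ≤ T → AbsolutelyContinuousOnInterval w 0 T) ∧
    ∀ᵐ t ∂(volume.restrict (Set.Ici (0 : ℝ))), ∃ v ∈ flowField a x y (w t), HasDerivAt w v t

/-- The uniform distribution on `{1, -1}`. -/
def signMeasure : Measure ℝ :=
  (2⁻¹ : ENNReal) • Measure.dirac 1 + (2⁻¹ : ENNReal) • Measure.dirac (-1)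

/-- The law of the initialization `(w(0), a)` with `κ = 1`: the `wₖ(0)` are standard Gaussian
vectors of `ℝ^{d+1}`, the `aₖ` are uniform signs, and all of them are independent. -/
def initMeasure (m d : ℕ) :
    Measure ((Fin m → EuclideanSpace ℝ (Fin (d + 1))) × (Fin m → ℝ)) :=
  (Measure.pi fun _ : Fin m => stdGaussian (EuclideanSpace ℝ (Fin (d + 1)))).prod
    (Measure.pi fun _ : Fin m => signMeasure)

/-- The `n × n` matrix `H = 𝔼[∇ᵀf₀ ∇f₀]`, the expectation being over the initialization. -/
def ntkMatrix (m : ℕ) {d n : ℕ} (x : Fin n → EuclideanSpace ℝ (Fin d)) :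
    Matrix (Fin n) (Fin n) ℝ :=
  Matrix.of fun i j => ∫ p, ⟪netGrad p.2 (x i) (assemble p.1),
    netGrad p.2 (x j) (assemble p.1)⟫_ℝ ∂(initMeasure m d)

end ShallowReLU

end

/-!
A wide network trained by gradient flow stays close to its linearization at the initialization.
Write `u = f - Y` for the residual, `G` for the matrix of gradients `∇f` along the flow, `G₀` for
its value at the initialization, and `D = d + 1 = ‖x̃ᵢ‖²`.

*Deterministic part.* The flow satisfies `ẇ = -G u` and, almost everywhere, `u̇ = -Gᵀ G u`
(`IsGradientFlow.ae_hasDerivAt`); the kinks of ReLU are harmless because a preactivation that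
vanishes at a time where both it and its ReLU are differentiable has derivative zero there
(`hasDerivAt_relu_comp`). Suppose that the initialization is good (`GoodInit`): `‖u(0)‖ ≤ U`,
`G₀ᵀ G₀ ≥ c / 2`, and few preactivations are so small that they can change sign while no neuron
moves
by more than `R`. Then `‖G - G₀‖ ≤ ε` as long as no neuron has moved by `R`, so `‖u‖` decays like
`e^{-ct/4}`, so the neurons travel less than `R`; by continuous induction this holds forever
(`GoodInit.norm_neuron_sub_lt`). To compare `w` with `w_L`, split `w - w_L` along the range of
`G₀`. The orthogonal component is driven by `(G - G₀) u` only. The component `z` in the range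
satisfies `ż = -G₀ u - (error)`, and `u = G₀ᵀ z + r`, where the linearization error `r` is at most
`ε ‖w - w(0)‖`, because a sign change contributes to `f - f_L` no more than to `G - G₀`
(`norm_residual_sub_linearization_le`). Since `G₀ G₀ᵀ ≥ c / 2` on the range, Grönwall's inequality
gives the rate `e^{-ct/2}` and a total error of `O(n D ε U / c²)`
(`GoodInit.exists_isMinNormInterpolant`).

*Probabilistic part.* Markov's inequality controls three quantities
(`initMeasure_not_goodInit_le`). The independent signs give `𝔼 f(xᵢ, w(0))² ≤ D`. A Gaussian
preactivation of variance `D` is at most `R √D` in absolute value with probability at most `R`.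
The empirical Gram matrix is an average of `m` independent terms bounded by `D`, so each of its
entries has variance at most `D² / m`. The choice `U ≍ Cy √(nD/δ)`, `R ≍ n D Cy / (c √(mδ))`,
`ε² ≍ n D R / δ` turns the lower bound on `m` into `10 ε ≤ √c` and the deterministic error into the
claimed one.

*Positive definiteness* (`posDef_ntkMatrix`). `vᵀ H v = 𝔼 ‖∑ᵢ vᵢ σ'(gᵀ x̃ᵢ) x̃ᵢ‖²`. If this
vanishes, the sum is zero for a dense set of `g`; crossing the hyperplane of `x̃ᵢ` at a point off
the other hyperplanes changes the sum by `vᵢ x̃ᵢ`, so `vᵢ = 0`.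
-/

/-! ### Differential inequalities for absolutely continuous functions -/

namespace AbsolutelyContinuousOnInterval

variable {X Y : Type*} [PseudoMetricSpace X] [PseudoMetricSpace Y]

lemma lipschitz_comp {f : ℝ → X} {a b : ℝ} {g : X → Y} {K : NNReal}
    (hg : LipschitzWith K g) (hf : AbsolutelyContinuousOnInterval f a b) :
    AbsolutelyContinuousOnInterval (fun t => g (f t)) a b := by
  have h : Filter.Tendsto
      (fun E : ℕ × (ℕ → ℝ × ℝ) =>
        (K : ℝ) * ∑ i ∈ Finset.range E.1, dist (f (E.2 i).1) (f (E.2 i).2))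
      (totalLengthFilter ⊓ Filter.principal (disjWithin a b)) (nhds 0) := by
    simpa using Filter.Tendsto.const_mul (K : ℝ) hf
  refine squeeze_zero (fun t => Finset.sum_nonneg fun i _ => dist_nonneg) (fun t => ?_) h
  rw [Finset.mul_sum]
  exact Finset.sum_le_sum fun i _ => hg.dist_le_mul _ _

/-- An absolutely continuous function with almost everywhere nonpositive derivative does not
increase. -/
lemma le_of_hasDerivAt_nonpos {φ : ℝ → ℝ} {a b : ℝ} (hab : a ≤ b)
    (hφ : AbsolutelyContinuousOnInterval φ a b)
    (h : ∀ᵐ t, t ∈ Set.Ioo a b → ∀ p, HasDerivAt φ p t → p ≤ 0) : φ b ≤ φ a := by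
  have h1 := hφ.integral_deriv_eq_sub
  have h2 : ∫ t in a..b, deriv φ t ≤ 0 := by
    rw [intervalIntegral.integral_of_le hab, integral_Ioc_eq_integral_Ioo]
    apply integral_nonpos_of_ae
    rw [Filter.EventuallyLE, ae_restrict_iff' measurableSet_Ioo]
    filter_upwards [h, hφ.ae_differentiableAt] with t ht hd hmem
    have hmem' : t ∈ Set.uIcc a b := by
      rw [Set.uIcc_of_le hab]; exact Set.Ioo_subset_Icc_self hmem
    exact ht hmem _ (hd hmem').hasDerivAt
  linarith

end AbsolutelyContinuousOnInterval

section DifferentialInequalities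

variable {F : Type*} [NormedAddCommGroup F] [InnerProductSpace ℝ F]

lemma absolutelyContinuousOnInterval_exp (lam a b : ℝ) :
    AbsolutelyContinuousOnInterval (fun t => Real.exp (lam * t)) a b :=
  ContDiffOn.absolutelyContinuousOnInterval (by fun_prop)

/-- The derivative of the norm along a curve that satisfies `⟪z, ż⟫ ≤ -lam ‖z‖² + η ‖z‖`. At a zero
of the curve the norm is minimal, so that its derivative vanishes there. -/
lemma deriv_norm_le_of_inner_le {z : ℝ → F} {z' : F} {t p lam η : ℝ} (hη : 0 ≤ η)
    (hz : HasDerivAt z z' t) (hp : HasDerivAt (fun s => ‖z s‖) p t)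
    (h : ⟪z t, z'⟫_ℝ ≤ -lam * ‖z t‖ ^ 2 + η * ‖z t‖) : p ≤ -lam * ‖z t‖ + η := by
  rcases eq_or_ne (z t) 0 with h0 | h0
  · have hmin : IsLocalMin (fun s => ‖z s‖) t :=
      Filter.Eventually.of_forall fun s => by simp [h0]
    rw [hmin.hasDerivAt_eq_zero hp, h0]
    simpa using hη
  · have hpos : 0 < ‖z t‖ := norm_pos_iff.mpr h0
    have h1 := hz.norm_sq
    have h2 := hp.fun_pow 2
    have h3 := h1.unique h2
    simp at h3
    have h4 : ‖z t‖ * p ≤ ‖z t‖ * (-lam * ‖z t‖ + η) := by nlinarith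
    exact le_of_mul_le_mul_left h4 hpos

/-- Grönwall's inequality for the norm of an absolutely continuous curve that satisfies
`⟪z, ż⟫ ≤ -lam ‖z‖² + η ‖z‖` almost everywhere. -/
lemma norm_le_exp_mul_norm_add {z : ℝ → F} {T lam η : ℝ} (hT : 0 ≤ T) (hlam : 0 < lam)
    (hη : 0 ≤ η) (hz : AbsolutelyContinuousOnInterval z 0 T)
    (h : ∀ᵐ t, t ∈ Set.Ioo 0 T → ∃ z', HasDerivAt z z' t ∧
      ⟪z t, z'⟫_ℝ ≤ -lam * ‖z t‖ ^ 2 + η * ‖z t‖) :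
    ‖z T‖ ≤ Real.exp (-(lam * T)) * ‖z 0‖ + η / lam := by
  have hn : AbsolutelyContinuousOnInterval (fun t => ‖z t‖) 0 T :=
    hz.lipschitz_comp lipschitzWith_one_norm
  have hψ : AbsolutelyContinuousOnInterval
      (fun t => Real.exp (lam * t) * (‖z t‖ + -(η / lam))) 0 T :=
    (absolutelyContinuousOnInterval_exp lam 0 T).fun_mul
      (hn.fun_add (ContDiffOn.absolutelyContinuousOnInterval (by fun_prop)))
  have key := hψ.le_of_hasDerivAt_nonpos hT <| by
    filter_upwards [h, hn.ae_differentiableAt] with t ht hd hmem q hq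
    obtain ⟨z', hz', hle⟩ := ht hmem
    have hmem' : t ∈ Set.uIcc 0 T := by
      rw [Set.uIcc_of_le hT]; exact Set.Ioo_subset_Icc_self hmem
    have hp := (hd hmem').hasDerivAt
    have hple := deriv_norm_le_of_inner_le hη hz' hp hle
    have he : HasDerivAt (fun s => Real.exp (lam * s)) (Real.exp (lam * t) * (lam * 1)) t :=
      ((hasDerivAt_id t).const_mul lam).exp
    have hq' := he.fun_mul (hp.add_const (-(η / lam)))
    rw [hq.unique hq']
    have e : Real.exp (lam * t) * (lam * 1) * (‖z t‖ + -(η / lam)) +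
        Real.exp (lam * t) * deriv (fun s => ‖z s‖) t
        = Real.exp (lam * t) * (lam * ‖z t‖ - η + deriv (fun s => ‖z s‖) t) := by
      field_simp
      ring
    rw [e]
    exact mul_nonpos_of_nonneg_of_nonpos (Real.exp_pos _).le (by linarith)
  simp only [mul_zero, Real.exp_zero, one_mul] at key
  have hE := Real.exp_pos (-(lam * T))
  have hEE : Real.exp (-(lam * T)) * Real.exp (lam * T) = 1 := by
    rw [← Real.exp_add]; simp
  have h5 := mul_le_mul_of_nonneg_left key hE.le
  rw [← mul_assoc, hEE, one_mul] at h5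
  have h6 : 0 ≤ Real.exp (-(lam * T)) * (η / lam) := by positivity
  linarith

/-- A curve with speed at most `K e^{-μ t}` stays within `K / μ` of its starting point. -/
lemma norm_sub_le_of_deriv_le_exp {g : ℝ → F} {T K μ : ℝ} (hT : 0 ≤ T) (hK : 0 ≤ K) (hμ : 0 < μ)
    (hg : AbsolutelyContinuousOnInterval g 0 T)
    (h : ∀ᵐ t, t ∈ Set.Ioo 0 T → ∃ g', HasDerivAt g g' t ∧ ‖g'‖ ≤ K * Real.exp (-μ * t)) :
    ‖g T - g 0‖ ≤ K / μ := by
  set v := g T - g 0 with hv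
  have hlip : AbsolutelyContinuousOnInterval (fun t => ⟪v, g t⟫_ℝ) 0 T :=
    hg.lipschitz_comp (g := fun w => ⟪v, w⟫_ℝ) (innerSL ℝ v).lipschitz
  have hψ : AbsolutelyContinuousOnInterval
      (fun t => ⟪v, g t⟫_ℝ + (‖v‖ * K / μ) * Real.exp (-μ * t)) 0 T :=
    hlip.fun_add ((absolutelyContinuousOnInterval_exp (-μ) 0 T).const_mul _)
  have key := hψ.le_of_hasDerivAt_nonpos hT <| by
    filter_upwards [h] with t ht hmem q hq
    obtain ⟨g', hg', hle⟩ := ht hmem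
    have he : HasDerivAt (fun s => Real.exp (-μ * s)) (Real.exp (-μ * t) * (-μ * 1)) t :=
      ((hasDerivAt_id t).const_mul (-μ)).exp
    have h1 : HasDerivAt (fun s => ⟪v, g s⟫_ℝ) ⟪v, g'⟫_ℝ t := by
      simpa using (hasDerivAt_const t v).inner ℝ hg'
    rw [hq.unique (h1.fun_add (he.const_mul _))]
    have h2 : ⟪v, g'⟫_ℝ ≤ ‖v‖ * (K * Real.exp (-μ * t)) :=
      (real_inner_le_norm _ _).trans (mul_le_mul_of_nonneg_left hle (norm_nonneg _))
    have h3 : ‖v‖ * K / μ * (Real.exp (-μ * t) * (-μ * 1)) = -(‖v‖ * (K * Real.exp (-μ * t))) := by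
      field_simp
    rw [h3]; linarith
  simp only [mul_zero, Real.exp_zero, mul_one] at key
  have h1 : ‖v‖ ^ 2 = ⟪v, g T⟫_ℝ - ⟪v, g 0⟫_ℝ := by
    rw [← inner_sub_right, ← hv, real_inner_self_eq_norm_sq]
  have h2 : 0 ≤ ‖v‖ * K / μ * Real.exp (-μ * T) := by positivity
  have h3 : ‖v‖ ^ 2 ≤ ‖v‖ * (K / μ) := by rw [h1, ← mul_div_assoc]; linarith
  rcases (norm_nonneg v).eq_or_lt with h0 | h0
  · rw [← h0]; positivity
  · rw [pow_two] at h3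
    exact le_of_mul_le_mul_left h3 h0

/-- Continuous induction: a continuous function that cannot reach the level `R` for the first time
stays below it. -/
lemma lt_of_forall_lt_imp_lt {h : ℝ → ℝ} {R : ℝ} (hc : ContinuousOn h (Set.Ici 0))
    (hstep : ∀ T, 0 ≤ T → (∀ t ∈ Set.Ico 0 T, h t < R) → h T < R) :
    ∀ t, 0 ≤ t → h t < R := by
  by_contra! hcon
  obtain ⟨t, ht0, ht⟩ := hcon
  have hclosed : IsClosed (Set.Ici (0 : ℝ) ∩ h ⁻¹' Set.Ici R) :=
    hc.preimage_isClosed_of_isClosed isClosed_Ici isClosed_Ici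
  have hbdd : BddBelow (Set.Ici (0 : ℝ) ∩ h ⁻¹' Set.Ici R) := ⟨0, fun s hs => hs.1⟩
  have hmem := hclosed.csInf_mem ⟨t, ht0, ht⟩ hbdd
  refine absurd (hstep _ hmem.1 fun s hs => ?_) (not_lt.mpr hmem.2)
  by_contra! hs'
  exact absurd (csInf_le hbdd ⟨hs.1, hs'⟩) (not_le.mpr hs.2)

end DifferentialInequalities

/-! ### The operator with prescribed columns -/

noncomputable section

namespace ShallowReLU

section Synthesis

variable {n : ℕ} {W : Type*} [NormedAddCommGroup W] [InnerProductSpace ℝ W]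

/-- The linear map `v ↦ ∑ᵢ vᵢ gᵢ` from `ℝⁿ`, that is, the matrix with columns `g₁, …, gₙ`. -/
def synthesis (g : Fin n → W) : EuclideanSpace ℝ (Fin n) →L[ℝ] W :=
  ∑ i, (EuclideanSpace.proj i : EuclideanSpace ℝ (Fin n) →L[ℝ] ℝ).smulRight (g i)

lemma synthesis_apply (g : Fin n → W) (v : EuclideanSpace ℝ (Fin n)) :
    synthesis g v = ∑ i, v i • g i := by
  simp [synthesis]

lemma synthesis_sub (g h : Fin n → W) : synthesis g - synthesis h = synthesis (g - h) := by
  ext v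
  simp [synthesis_apply, smul_sub]

lemma norm_synthesis_le (g : Fin n → W) : ‖synthesis g‖ ≤ √(∑ i, ‖g i‖ ^ 2) := by
  refine ContinuousLinearMap.opNorm_le_bound _ (Real.sqrt_nonneg _) fun v => ?_
  rw [synthesis_apply, EuclideanSpace.norm_eq, mul_comm]
  calc ‖∑ i, v i • g i‖ ≤ ∑ i, ‖v i‖ * ‖g i‖ :=
        (norm_sum_le _ _).trans_eq (Finset.sum_congr rfl fun i _ => norm_smul _ _)
    _ ≤ _ := Real.sum_mul_le_sqrt_mul_sqrt _ _ _

variable [CompleteSpace W]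

lemma adjoint_synthesis_apply (g : Fin n → W) (w : W) (i : Fin n) :
    ContinuousLinearMap.adjoint (synthesis g) w i = ⟪g i, w⟫_ℝ := by
  have h := ContinuousLinearMap.adjoint_inner_right (synthesis g) (EuclideanSpace.single i 1) w
  rw [synthesis_apply, Finset.sum_eq_single i (by intro j _ hj; simp [hj]) (by simp)] at h
  simpa [EuclideanSpace.inner_single_left] using h

end Synthesis

section BoundedBelow

variable {E W : Type*} [NormedAddCommGroup E] [InnerProductSpace ℝ E] [CompleteSpace E]
  [NormedAddCommGroup W] [InnerProductSpace ℝ W] [CompleteSpace W]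

open ContinuousLinearMap in
/-- A map that is bounded below has an invertible Gram operator. -/
lemma exists_adjoint_apply_eq [FiniteDimensional ℝ E] {G : E →L[ℝ] W} {lam : ℝ} (hlam : 0 < lam)
    (hG : ∀ v, lam * ‖v‖ ^ 2 ≤ ‖G v‖ ^ 2) (b : E) :
    ∃ v, adjoint G (G v) = b := by
  have hinj : Function.Injective ((adjoint G ∘L G : E →L[ℝ] E) : E →ₗ[ℝ] E) := by
    refine (injective_iff_map_eq_zero _).2 fun v hv => ?_
    have h1 : ‖G v‖ ^ 2 = 0 := by
      rw [← real_inner_self_eq_norm_sq, ← adjoint_inner_right]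
      have : adjoint G (G v) = 0 := hv
      simp [this]
    have h2 := hG v
    rw [h1] at h2
    have h3 : ‖v‖ ^ 2 ≤ 0 := by
      by_contra! h; nlinarith [mul_pos hlam h]
    simpa using le_antisymm h3 (by positivity)
  exact LinearMap.surjective_of_injective hinj b

open ContinuousLinearMap in
/-- If `Gᵀ G ≥ lam`, then `G Gᵀ ≥ lam` on the range of `G`. -/
lemma mul_norm_sq_le_norm_adjoint_sq {G : E →L[ℝ] W} {lam : ℝ} (hlam : 0 < lam)
    (hG : ∀ v, lam * ‖v‖ ^ 2 ≤ ‖G v‖ ^ 2) (v : E) :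
    lam * ‖G v‖ ^ 2 ≤ ‖adjoint G (G v)‖ ^ 2 := by
  have h1 : ‖G v‖ ^ 2 ≤ ‖v‖ * ‖adjoint G (G v)‖ := by
    rw [← real_inner_self_eq_norm_sq, ← adjoint_inner_right]
    exact real_inner_le_norm _ _
  have h2 := hG v
  rcases (norm_nonneg (G v)).eq_or_lt with h0 | h0
  · rw [← h0]; simp
  · have h3 : ‖G v‖ ^ 2 * (lam * ‖G v‖ ^ 2) ≤ ‖G v‖ ^ 2 * ‖adjoint G (G v)‖ ^ 2 := by
      calc ‖G v‖ ^ 2 * (lam * ‖G v‖ ^ 2) = lam * (‖G v‖ ^ 2) ^ 2 := by ring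
        _ ≤ lam * (‖v‖ * ‖adjoint G (G v)‖) ^ 2 := by gcongr
        _ = (lam * ‖v‖ ^ 2) * ‖adjoint G (G v)‖ ^ 2 := by ring
        _ ≤ _ := by gcongr
    exact le_of_mul_le_mul_left h3 (by positivity)

end BoundedBelow

/-! ### Neurons, gradients and residuals -/

variable {m d n : ℕ}

lemma neuron_sub (w w' : Weights m d) (k : Fin m) :
    neuron (w - w') k = neuron w k - neuron w' k := rfl

lemma neuron_assemble (v : Fin m → EuclideanSpace ℝ (Fin (d + 1))) (k : Fin m) :
    neuron (assemble v) k = v k := rfl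

/-- `w ↦ wₖ` as a continuous linear map. -/
def neuronCLM (k : Fin m) : Weights m d →L[ℝ] EuclideanSpace ℝ (Fin (d + 1)) :=
  LinearMap.toContinuousLinearMap
    { toFun := fun w => neuron w k
      map_add' := fun _ _ => rfl
      map_smul' := fun _ _ => rfl }

@[simp]
lemma neuronCLM_apply (k : Fin m) (w : Weights m d) : neuronCLM k w = neuron w k := rfl

lemma inner_eq_sum_neuron (w w' : Weights m d) : ⟪w, w'⟫_ℝ = ∑ k, ⟪neuron w k, neuron w' k⟫_ℝ := by
  simp only [PiLp.inner_apply, Fintype.sum_prod_type]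
  rfl

lemma norm_sq_eq_sum_neuron (w : Weights m d) : ‖w‖ ^ 2 = ∑ k, ‖neuron w k‖ ^ 2 := by
  rw [← real_inner_self_eq_norm_sq, inner_eq_sum_neuron]
  simp only [real_inner_self_eq_norm_sq]

lemma inner_gradWith (a : Fin m → ℝ) (x : EuclideanSpace ℝ (Fin d)) (s : Fin m → ℝ)
    (w : Weights m d) :
    ⟪gradWith a x s, w⟫_ℝ = ∑ k, a k / √m * s k * ⟪neuron w k, augment x⟫_ℝ := by
  rw [inner_eq_sum_neuron]
  refine Finset.sum_congr rfl fun k _ => ?_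
  rw [gradWith, neuron_assemble, real_inner_smul_left, real_inner_comm]

lemma norm_gradWith_sq {a : Fin m → ℝ} (ha : ∀ k, a k ^ 2 = 1) (x : EuclideanSpace ℝ (Fin d))
    (s : Fin m → ℝ) : ‖gradWith a x s‖ ^ 2 = (∑ k, s k ^ 2) * ‖augment x‖ ^ 2 / m := by
  rw [norm_sq_eq_sum_neuron, Finset.sum_mul, Finset.sum_div]
  refine Finset.sum_congr rfl fun k _ => ?_
  rw [gradWith, neuron_assemble, norm_smul, mul_pow, Real.norm_eq_abs, sq_abs, mul_pow, div_pow,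
    ha k, Real.sq_sqrt (Nat.cast_nonneg _)]
  ring

lemma gradWith_sub (a : Fin m → ℝ) (x : EuclideanSpace ℝ (Fin d)) (s s' : Fin m → ℝ) :
    gradWith a x s - gradWith a x s' = gradWith a x (s - s') := by
  ext q
  simp [gradWith, assemble]
  ring

/-- The residual vector `f - Y`. -/
def residual (a : Fin m → ℝ) (x : Fin n → EuclideanSpace ℝ (Fin d)) (y : Fin n → ℝ)
    (w : Weights m d) : EuclideanSpace ℝ (Fin n) :=
  WithLp.toLp 2 fun i => net a (x i) w - y i

/-- The matrix with columns `gradWith a xᵢ sᵢ`; for `sᵢₖ = σ'(wₖᵀ x̃ᵢ)` it is `∇f`. -/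
def gradOp (a : Fin m → ℝ) (x : Fin n → EuclideanSpace ℝ (Fin d)) (s : Fin n → Fin m → ℝ) :
    EuclideanSpace ℝ (Fin n) →L[ℝ] Weights m d :=
  synthesis fun i => gradWith a (x i) (s i)

/-- The activation pattern `σ'(wₖᵀ x̃ᵢ)` of the weights `w`. -/
def pattern (x : Fin n → EuclideanSpace ℝ (Fin d)) (w : Weights m d) : Fin n → Fin m → ℝ :=
  fun i k => reluDeriv ⟪neuron w k, augment (x i)⟫_ℝ

/-- The number of pairs of a neuron and an input whose preactivation is at most `r` in absolute
value. Only those can change sign when the preactivations move by at most `r`. -/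
def nearKinkCount (x : Fin n → EuclideanSpace ℝ (Fin d)) (w : Weights m d) (r : ℝ) : ℝ :=
  ∑ i, ∑ k, if |⟪neuron w k, augment (x i)⟫_ℝ| ≤ r then (1 : ℝ) else 0

lemma mem_flowField_iff {a : Fin m → ℝ} {x : Fin n → EuclideanSpace ℝ (Fin d)} {y : Fin n → ℝ}
    {w v : Weights m d} : v ∈ flowField a x y w ↔
      ∃ s : Fin n → Fin m → ℝ, (∀ i k, s i k ∈ reluSubderiv ⟪neuron w k, augment (x i)⟫_ℝ) ∧
        v = -gradOp a x s (residual a x y w) := by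
  simp [flowField, gradOp, synthesis_apply, residual]

lemma gradOp_sub (a : Fin m → ℝ) (x : Fin n → EuclideanSpace ℝ (Fin d))
    (s s' : Fin n → Fin m → ℝ) : gradOp a x s - gradOp a x s' = gradOp a x (s - s') := by
  rw [gradOp, gradOp, synthesis_sub, gradOp]
  congr 1
  ext1 i
  exact gradWith_sub a (x i) (s i) (s' i)

section Estimates

variable {a : Fin m → ℝ} {x : Fin n → EuclideanSpace ℝ (Fin d)} {D : ℝ}

lemma norm_gradOp_le (ha : ∀ k, a k ^ 2 = 1) (hx : ∀ i, ‖augment (x i)‖ ^ 2 = D)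
    (s : Fin n → Fin m → ℝ) : ‖gradOp a x s‖ ≤ √(D * (∑ i, ∑ k, s i k ^ 2) / m) := by
  refine (norm_synthesis_le _).trans (Real.sqrt_le_sqrt (le_of_eq ?_))
  rw [Finset.mul_sum, Finset.sum_div]
  refine Finset.sum_congr rfl fun i _ => ?_
  rw [norm_gradWith_sq ha, hx]
  ring

lemma norm_gradOp_le_of_abs_le_one (hm : 0 < m) (hD : 0 ≤ D) (ha : ∀ k, a k ^ 2 = 1)
    (hx : ∀ i, ‖augment (x i)‖ ^ 2 = D) {s : Fin n → Fin m → ℝ} (hs : ∀ i k, |s i k| ≤ 1) :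
    ‖gradOp a x s‖ ≤ √(n * D) := by
  refine (norm_gradOp_le ha hx s).trans (Real.sqrt_le_sqrt ?_)
  have hm' : (0 : ℝ) < m := Nat.cast_pos.mpr hm
  rw [div_le_iff₀ hm']
  have : ∑ i, ∑ k, s i k ^ 2 ≤ ∑ i : Fin n, ∑ k : Fin m, (1 : ℝ) := by
    gcongr with i _ k _
    exact (sq_le_one_iff_abs_le_one _).2 (hs i k)
  simp at this
  calc D * (∑ i, ∑ k, s i k ^ 2) ≤ D * (n * m) := by gcongr
    _ = _ := by ring

/-- A perturbation of the activation pattern that is supported on small preactivations is small. -/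
lemma norm_gradOp_le_of_nearKink (hD : 0 ≤ D) (ha : ∀ k, a k ^ 2 = 1)
    (hx : ∀ i, ‖augment (x i)‖ ^ 2 = D) {w₀ : Weights m d} {r ε : ℝ} (hε : 0 ≤ ε)
    (hcount : D * nearKinkCount x w₀ r / m ≤ ε ^ 2) {s : Fin n → Fin m → ℝ}
    (hs : ∀ i k, |s i k| ≤ if |⟪neuron w₀ k, augment (x i)⟫_ℝ| ≤ r then 1 else 0) :
    ‖gradOp a x s‖ ≤ ε := by
  refine (norm_gradOp_le ha hx s).trans ((Real.sqrt_le_sqrt ?_).trans_eq (Real.sqrt_sq hε))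
  refine le_trans ?_ hcount
  rw [nearKinkCount]
  gcongr with i _ k _
  rw [← sq_abs]
  have h := hs i k
  split_ifs at h ⊢ with hc
  · exact pow_le_one₀ (abs_nonneg _) h
  · rw [le_antisymm h (abs_nonneg _)]; simp

/-- The slope of ReLU does not change under a perturbation smaller than the preactivation. -/
lemma abs_reluSubderiv_sub_le {z z₀ s r : ℝ} (hs : s ∈ reluSubderiv z) (hz : |z - z₀| ≤ r) :
    |s - reluDeriv z₀| ≤ if |z₀| ≤ r then 1 else 0 := by
  obtain ⟨h1, h2, h3, h4⟩ := hs
  rw [abs_le] at hz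
  split_ifs with hc
  · unfold reluDeriv
    split_ifs <;> rw [abs_le] <;> constructor <;> linarith
  · unfold reluDeriv
    rw [not_le, lt_abs] at hc
    rcases hc with hc | hc
    · rw [if_pos (by linarith), h1 (by linarith)]; simp
    · rw [if_neg (by linarith), h2 (by linarith)]; simp

/-- The linearization error of ReLU at `z₀` is the increment times a factor in `[-1, 1]` that
vanishes unless the sign changes. -/
lemma exists_relu_eq_add_mul {z z₀ r : ℝ} (hz : |z - z₀| ≤ r) :
    ∃ θ : ℝ, (|θ| ≤ if |z₀| ≤ r then 1 else 0) ∧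
      relu z - (relu z₀ + reluDeriv z₀ * (z - z₀)) = θ * (z - z₀) := by
  have hz' := abs_le.1 hz
  have hmem : reluDeriv z ∈ reluSubderiv z := by
    unfold reluDeriv reluSubderiv
    refine ⟨fun h => if_pos h.le, fun h => if_neg (not_le.2 h), ?_, ?_⟩ <;> split_ifs <;> norm_num
  have hb := abs_reluSubderiv_sub_le hmem hz
  rcases eq_or_ne (z - z₀) 0 with h0 | h0
  · refine ⟨0, by simp; split_ifs <;> norm_num, ?_⟩
    rw [h0, sub_eq_zero.1 h0]; simp
  · refine ⟨(reluDeriv z - reluDeriv z₀) * z / (z - z₀), ?_, ?_⟩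
    · -- when the sign changes, `z₀` and `z` lie on different sides of `0`, hence `|z| ≤ |z - z₀|`
      have h1 : |(reluDeriv z - reluDeriv z₀) * z| ≤ |reluDeriv z - reluDeriv z₀| * |z - z₀| := by
        rw [abs_mul]
        rcases le_or_gt 0 z with hp | hp <;> rcases le_or_gt 0 z₀ with hq | hq <;>
          simp [reluDeriv, hp, hq, not_le.2, abs_of_nonneg, abs_of_neg]
        · exact (le_abs_self _).trans' (by linarith)
        · rw [abs_of_neg (by linarith : z - z₀ < 0)]; linarith
      rw [abs_div, div_le_iff₀ (abs_pos.2 h0)]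
      exact h1.trans (mul_le_mul_of_nonneg_right hb (abs_nonneg _))
    · rw [div_mul_cancel₀ _ h0]
      have hr : ∀ t : ℝ, relu t = reluDeriv t * t := by
        intro t
        unfold relu reluDeriv
        split_ifs with h
        · simp [h]
        · simp [(not_le.1 h).le]
      rw [hr, hr]; ring

lemma abs_inner_neuron_sub_le (hx : ∀ i, ‖augment (x i)‖ ^ 2 = D) {w w₀ : Weights m d} {R : ℝ}
    (hR : ∀ k, ‖neuron w k - neuron w₀ k‖ ≤ R) (i : Fin n) (k : Fin m) :
    |⟪neuron w k, augment (x i)⟫_ℝ - ⟪neuron w₀ k, augment (x i)⟫_ℝ| ≤ R * √D := by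
  rw [← inner_sub_left]
  refine (abs_real_inner_le_norm _ _).trans ?_
  rw [← hx i, Real.sqrt_sq (norm_nonneg _)]
  gcongr
  exact hR k

/-- While no neuron has moved by more than `R`, every admissible gradient is `ε`-close to the
initial one. -/
lemma norm_gradOp_sub_le (hD : 0 ≤ D) (ha : ∀ k, a k ^ 2 = 1)
    (hx : ∀ i, ‖augment (x i)‖ ^ 2 = D) {w w₀ : Weights m d} {R ε : ℝ} (hε : 0 ≤ ε)
    (hcount : D * nearKinkCount x w₀ (R * √D) / m ≤ ε ^ 2)
    (hR : ∀ k, ‖neuron w k - neuron w₀ k‖ ≤ R) {s : Fin n → Fin m → ℝ}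
    (hs : ∀ i k, s i k ∈ reluSubderiv ⟪neuron w k, augment (x i)⟫_ℝ) :
    ‖gradOp a x s - gradOp a x (pattern x w₀)‖ ≤ ε := by
  rw [gradOp_sub]
  exact norm_gradOp_le_of_nearKink hD ha hx hε hcount fun i k =>
    abs_reluSubderiv_sub_le (hs i k) (abs_inner_neuron_sub_le hx hR i k)

/-- While no neuron has moved by more than `R`, the network differs from its linearization by at
most `ε ‖w - w₀‖`. -/
lemma norm_residual_sub_linearization_le (hD : 0 ≤ D) (ha : ∀ k, a k ^ 2 = 1)
    (hx : ∀ i, ‖augment (x i)‖ ^ 2 = D) (y : Fin n → ℝ) {w w₀ : Weights m d} {R ε : ℝ} (hε : 0 ≤ ε)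
    (hcount : D * nearKinkCount x w₀ (R * √D) / m ≤ ε ^ 2)
    (hR : ∀ k, ‖neuron w k - neuron w₀ k‖ ≤ R) :
    ‖residual a x y w - (residual a x y w₀ +
      ContinuousLinearMap.adjoint (gradOp a x (pattern x w₀)) (w - w₀))‖ ≤ ε * ‖w - w₀‖ := by
  choose θ hθ1 hθ2 using fun i k =>
    exists_relu_eq_add_mul (abs_inner_neuron_sub_le hx hR i k)
  have heq : residual a x y w - (residual a x y w₀ +
      ContinuousLinearMap.adjoint (gradOp a x (pattern x w₀)) (w - w₀)) =
      ContinuousLinearMap.adjoint (gradOp a x θ) (w - w₀) := by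
    ext i
    simp only [PiLp.sub_apply, PiLp.add_apply, gradOp, adjoint_synthesis_apply, inner_gradWith,
      residual, net, neuron_sub, inner_sub_left, pattern]
    have h : ∑ k, a k / √m * relu ⟪neuron w k, augment (x i)⟫_ℝ =
        ∑ k, a k / √m * relu ⟪neuron w₀ k, augment (x i)⟫_ℝ +
        ∑ k, a k / √m * reluDeriv ⟪neuron w₀ k, augment (x i)⟫_ℝ *
          (⟪neuron w k, augment (x i)⟫_ℝ - ⟪neuron w₀ k, augment (x i)⟫_ℝ) +
        ∑ k, a k / √m * θ i k *
          (⟪neuron w k, augment (x i)⟫_ℝ - ⟪neuron w₀ k, augment (x i)⟫_ℝ) := by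
      rw [← Finset.sum_add_distrib, ← Finset.sum_add_distrib]
      refine Finset.sum_congr rfl fun k _ => ?_
      linear_combination (a k / √m) * hθ2 i k
    linarith
  rw [heq]
  refine (ContinuousLinearMap.le_opNorm _ _).trans ?_
  rw [LinearIsometryEquiv.norm_map]
  gcongr
  exact norm_gradOp_le_of_nearKink hD ha hx hε hcount hθ1

/-- A single neuron moves at a speed of order `1 / √m`. -/
lemma norm_neuron_gradOp_le (ha : ∀ k, a k ^ 2 = 1) (hx : ∀ i, ‖augment (x i)‖ ^ 2 = D)
    {s : Fin n → Fin m → ℝ} (hs : ∀ i k, |s i k| ≤ 1) (v : EuclideanSpace ℝ (Fin n)) (k : Fin m) :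
    ‖neuron (gradOp a x s v) k‖ ≤ √(n * D / m) * ‖v‖ := by
  have h1 : neuron (gradOp a x s v) k =
      synthesis (fun i => (a k / √m * s i k) • augment (x i)) v := by
    rw [← neuronCLM_apply, gradOp, synthesis_apply, map_sum, synthesis_apply]
    refine Finset.sum_congr rfl fun i _ => ?_
    rw [map_smul, neuronCLM_apply, gradWith, neuron_assemble]
  rw [h1]
  refine (ContinuousLinearMap.le_opNorm _ _).trans ?_
  gcongr
  refine (norm_synthesis_le _).trans (Real.sqrt_le_sqrt ?_)
  calc ∑ i, ‖(a k / √m * s i k) • augment (x i)‖ ^ 2 ≤ ∑ i : Fin n, D / m := by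
        gcongr with i
        rw [norm_smul, mul_pow, hx, Real.norm_eq_abs, sq_abs, mul_pow, div_pow, ha,
          Real.sq_sqrt (Nat.cast_nonneg _)]
        have : s i k ^ 2 ≤ 1 := (sq_le_one_iff_abs_le_one _).2 (hs i k)
        have hD : 0 ≤ D := by rw [← hx i]; positivity
        calc 1 / (m : ℝ) * s i k ^ 2 * D ≤ 1 / (m : ℝ) * 1 * D := by gcongr
          _ = D / m := by ring
    _ = n * D / m := by simp; ring

end Estimates

/-! ### The chain rule along a gradient flow -/

/-- The chain rule for ReLU with an arbitrary admissible derivative at the kink. If `φ t = 0` and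
`relu ∘ φ` is differentiable at `t`, then both `relu ∘ φ` and `relu ∘ φ - φ = relu ∘ (-φ)` have a
minimum at `t`, hence `φ' = 0` and the choice of the derivative is immaterial. -/
lemma hasDerivAt_relu_comp {φ : ℝ → ℝ} {φ' s t : ℝ} (hφ : HasDerivAt φ φ' t)
    (hd : DifferentiableAt ℝ (fun τ => relu (φ τ)) t) (hs : s ∈ reluSubderiv (φ t)) :
    HasDerivAt (fun τ => relu (φ τ)) (s * φ') t := by
  rcases lt_trichotomy (φ t) 0 with h | h | h
  · rw [hs.2.1 h, zero_mul]
    refine (hasDerivAt_const t (0 : ℝ)).congr_of_eventuallyEq ?_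
    filter_upwards [hφ.continuousAt.eventually_lt_const h] with τ hτ
    exact max_eq_left hτ.le
  · have h1 : IsLocalMin (fun τ => relu (φ τ)) t :=
      Filter.Eventually.of_forall fun τ => by simp [relu, h]
    have h2 : IsLocalMin (fun τ => relu (φ τ) - φ τ) t :=
      Filter.Eventually.of_forall fun τ => by simp [relu, h]
    have e1 := h1.hasDerivAt_eq_zero hd.hasDerivAt
    have e2 := h2.hasDerivAt_eq_zero (hd.hasDerivAt.sub hφ)
    have e3 : s * φ' = deriv (fun τ => relu (φ τ)) t := by
      have : φ' = 0 := by linarith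
      rw [this, e1, mul_zero]
    rw [e3]
    exact hd.hasDerivAt
  · rw [hs.1 h, one_mul]
    refine hφ.congr_of_eventuallyEq ?_
    filter_upwards [hφ.continuousAt.eventually_const_lt h] with τ hτ
    exact max_eq_right hτ.le

lemma hasDerivAt_toLp {f : ℝ → Fin n → ℝ} {f' : Fin n → ℝ} {t : ℝ}
    (h : ∀ i, HasDerivAt (fun τ => f τ i) (f' i) t) :
    HasDerivAt (fun τ => (WithLp.toLp 2 (f τ) : EuclideanSpace ℝ (Fin n))) (WithLp.toLp 2 f') t :=
  (PiLp.continuousLinearEquiv 2 ℝ fun _ : Fin n => ℝ).symm.hasFDerivAt.comp_hasDerivAt t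
    (hasDerivAt_pi.2 h)

lemma lipschitzWith_relu : LipschitzWith 1 relu :=
  LipschitzWith.const_max LipschitzWith.id 0

lemma exists_lipschitzWith_preactivation (v : EuclideanSpace ℝ (Fin (d + 1))) (k : Fin m) :
    ∃ K, LipschitzWith K fun w : Weights m d => ⟪neuron w k, v⟫_ℝ := by
  have h := ((innerSL ℝ v).comp (neuronCLM (d := d) k)).lipschitz
  refine ⟨‖(innerSL ℝ v).comp (neuronCLM (d := d) k)‖₊, fun p q => ?_⟩
  simpa [real_inner_comm] using h p q

section

variable {a : Fin m → ℝ} {x : Fin n → EuclideanSpace ℝ (Fin d)} {y : Fin n → ℝ}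
  {w₀ : Weights m d} {w : ℝ → Weights m d}

lemma _root_.AbsolutelyContinuousOnInterval.residual {b b' : ℝ}
    (hw : AbsolutelyContinuousOnInterval w b b') :
    AbsolutelyContinuousOnInterval (fun t => residual a x y (w t)) b b' := by
  have hlip : ∀ i, ∃ K, LipschitzWith K fun w : Weights m d => net a (x i) w - y i := by
    intro i
    choose K hK using exists_lipschitzWith_preactivation (m := m) (augment (x i))
    have h : ∀ s : Finset (Fin m), ∃ K', LipschitzWith K' fun w : Weights m d =>
        ∑ k ∈ s, a k / √m * relu ⟪neuron w k, augment (x i)⟫_ℝ := by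
      intro s
      induction s using Finset.cons_induction with
      | empty => exact ⟨0, by simp⟩
      | cons k s hk ih =>
        obtain ⟨K', hK'⟩ := ih
        simp only [Finset.sum_cons]
        exact ⟨_, ((lipschitzWith_smul (a k / √m)).comp
          (lipschitzWith_relu.comp (hK k))).add hK'⟩
    obtain ⟨K', hK'⟩ := h Finset.univ
    exact ⟨_, hK'.sub (LipschitzWith.const (y i))⟩
  choose K hK using hlip
  have hpi : LipschitzWith (Finset.univ.sup K) fun (w : Weights m d) i => net a (x i) w - y i :=
    fun p q => edist_pi_le_iff.2 fun i => (hK i).weaken (Finset.le_sup (Finset.mem_univ i)) p q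
  exact hw.lipschitz_comp
    ((PiLp.continuousLinearEquiv 2 ℝ fun _ : Fin n => ℝ).symm.lipschitz.comp hpi)

/-- Along a gradient flow the residual satisfies `u̇ = -∇fᵀ ∇f u` almost everywhere, with the same
choice of `σ'` at the kinks as in the equation for the weights. -/
lemma IsGradientFlow.ae_hasDerivAt (hw : IsGradientFlow a x y w₀ w) {T : ℝ} (hT : 0 ≤ T) :
    ∀ᵐ t, t ∈ Set.Ioo 0 T → ∃ s : Fin n → Fin m → ℝ,
      (∀ i k, s i k ∈ reluSubderiv ⟪neuron (w t) k, augment (x i)⟫_ℝ) ∧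
      HasDerivAt w (-gradOp a x s (residual a x y (w t))) t ∧
      HasDerivAt (fun τ => residual a x y (w τ))
        (-ContinuousLinearMap.adjoint (gradOp a x s) (gradOp a x s (residual a x y (w t)))) t := by
  obtain ⟨-, hac, hae⟩ := hw
  have hac := hac T hT
  have hdiff : ∀ᵐ t, ∀ i k, t ∈ Set.uIcc 0 T →
      DifferentiableAt ℝ (fun τ => relu ⟪neuron (w τ) k, augment (x i)⟫_ℝ) t := by
    refine ae_all_iff.2 fun i => ae_all_iff.2 fun k => ?_
    obtain ⟨K, hK⟩ := exists_lipschitzWith_preactivation (m := m) (augment (x i)) k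
    exact (hac.lipschitz_comp (lipschitzWith_relu.comp hK)).ae_differentiableAt
  rw [ae_restrict_iff' measurableSet_Ici] at hae
  filter_upwards [hae, hdiff] with t ht hd hmem
  obtain ⟨v, hv, hwv⟩ := ht hmem.1.le
  obtain ⟨s, hs, rfl⟩ := mem_flowField_iff.1 hv
  refine ⟨s, hs, hwv, ?_⟩
  have hmem' : t ∈ Set.uIcc 0 T := by
    rw [Set.uIcc_of_le hT]; exact Set.Ioo_subset_Icc_self hmem
  set v := -gradOp a x s (residual a x y (w t)) with hv_def
  have hres := hasDerivAt_toLp (n := n) (t := t) (f := fun τ i => net a (x i) (w τ) - y i)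
    (f' := fun i => ⟪gradWith a (x i) (s i), v⟫_ℝ) (fun i => ?_)
  · refine hres.congr_deriv ?_
    rw [← map_neg, ← hv_def]
    ext i
    rw [gradOp, adjoint_synthesis_apply]
  · refine HasDerivAt.sub_const _ ?_
    rw [inner_gradWith]
    refine HasDerivAt.fun_sum fun k _ => ?_
    have h1 : HasDerivAt (fun τ => ⟪neuron (w τ) k, augment (x i)⟫_ℝ)
        ⟪neuron v k, augment (x i)⟫_ℝ t := by
      have := (neuronCLM (d := d) k).hasFDerivAt.comp_hasDerivAt t hwv
      simpa using this.inner ℝ (hasDerivAt_const t (augment (x i)))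
    have h2 := (hasDerivAt_relu_comp h1 (hd i k hmem') (hs i k)).const_mul (a k / √m)
    exact h2.congr_deriv (by ring)

end

/-! ### The minimum-norm interpolant of the linearization -/

section

variable {a : Fin m → ℝ} {x : Fin n → EuclideanSpace ℝ (Fin d)} {y : Fin n → ℝ}
  {w₀ : Weights m d}

open ContinuousLinearMap

/-- The interpolation constraints in matrix form. -/
lemma netLin_eq_iff (w : Weights m d) : (∀ i, netLin a w₀ (x i) w = y i) ↔
    adjoint (gradOp a x (pattern x w₀)) (w - w₀) = -residual a x y w₀ := by
  have h : ∀ i, adjoint (gradOp a x (pattern x w₀)) (w - w₀) i =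
      ⟪netGrad a (x i) w₀, w - w₀⟫_ℝ := fun i => adjoint_synthesis_apply _ _ i
  constructor
  · intro hw
    ext i
    have := hw i
    simp only [netLin] at this
    simp only [h, PiLp.neg_apply, residual]
    linarith
  · intro hw i
    have := congrArg (fun v : EuclideanSpace ℝ (Fin n) => v i) hw
    simp only [h, PiLp.neg_apply, residual] at this
    simp only [netLin]
    linarith

/-- An interpolant of the linearization whose displacement lies in the span of the gradients is the
one of minimal norm. -/
lemma isMinNormInterpolant_add {v : EuclideanSpace ℝ (Fin n)}
    (hv : adjoint (gradOp a x (pattern x w₀)) (gradOp a x (pattern x w₀) v) =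
      -residual a x y w₀) :
    IsMinNormInterpolant a w₀ x y (w₀ + gradOp a x (pattern x w₀) v) := by
  set G := gradOp a x (pattern x w₀) with hG
  refine ⟨(netLin_eq_iff _).2 (by rw [add_sub_cancel_left, ← hG, hv]), fun w hw => ?_⟩
  rw [netLin_eq_iff, ← hG, ← hv] at hw
  rw [add_sub_cancel_left]
  have h1 : ‖G v‖ ^ 2 = ⟪G v, w - w₀⟫_ℝ := by
    rw [← adjoint_inner_right, hw, adjoint_inner_right, real_inner_self_eq_norm_sq]
  have h2 := real_inner_le_norm (G v) (w - w₀)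
  rcases (norm_nonneg (G v)).eq_or_lt with h0 | h0
  · rw [← h0]; exact norm_nonneg _
  · refine le_of_mul_le_mul_left ?_ h0
    rw [← pow_two]; linarith

end

/-! ### Gradient flow from a good initialization -/

/-- The properties of the initialization that confine the gradient flow to the lazy regime: the
residual is at most `U`, the Gram matrix of the gradients is at least `c / 2`, and so few
preactivations are small that moving every neuron by at most `R` changes the gradient by at most
`ε`. The radius `R` exceeds the distance that a neuron travels while the residual decays like
`U e^{-ct/4}`. -/
structure GoodInit (a : Fin m → ℝ) (x : Fin n → EuclideanSpace ℝ (Fin d)) (y : Fin n → ℝ)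
    (w₀ : Weights m d) (D c U R ε : ℝ) : Prop where
  m_pos : 0 < m
  c_pos : 0 < c
  D_nonneg : 0 ≤ D
  ε_nonneg : 0 ≤ ε
  sign_sq : ∀ k, a k ^ 2 = 1
  norm_augment_sq : ∀ i, ‖augment (x i)‖ ^ 2 = D
  ε_le : 10 * ε ≤ √c
  lt_R : √(n * D / m) * U / (c / 4) < R
  norm_residual_le : ‖residual a x y w₀‖ ≤ U
  count_le : D * nearKinkCount x w₀ (R * √D) / m ≤ ε ^ 2
  le_norm_gradOp : ∀ v, c / 2 * ‖v‖ ^ 2 ≤ ‖gradOp a x (pattern x w₀) v‖ ^ 2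

lemma abs_le_one_of_mem_reluSubderiv {s z : ℝ} (hs : s ∈ reluSubderiv z) : |s| ≤ 1 :=
  abs_le.2 ⟨by linarith [hs.2.2.1], hs.2.2.2⟩

namespace GoodInit

open ContinuousLinearMap

variable {a : Fin m → ℝ} {x : Fin n → EuclideanSpace ℝ (Fin d)} {y : Fin n → ℝ}
  {w₀ : Weights m d} {D c U R ε : ℝ}

lemma U_nonneg (h : GoodInit a x y w₀ D c U R ε) : 0 ≤ U :=
  (norm_nonneg _).trans h.norm_residual_le

lemma R_pos (h : GoodInit a x y w₀ D c U R ε) : 0 < R := by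
  have := h.c_pos
  have := h.U_nonneg
  exact lt_of_le_of_lt (by positivity) h.lt_R

/-- While the neurons are close to their initial positions, the Gram matrix of the gradients is at
least `c / 4`. -/
lemma le_norm_gradOp_of_close (h : GoodInit a x y w₀ D c U R ε) {s : Fin n → Fin m → ℝ}
    (hs : ‖gradOp a x s - gradOp a x (pattern x w₀)‖ ≤ ε) (v : EuclideanSpace ℝ (Fin n)) :
    c / 4 * ‖v‖ ^ 2 ≤ ‖gradOp a x s v‖ ^ 2 := by
  have hc := h.c_pos
  set G := gradOp a x (pattern x w₀) with hG
  -- `√(c / 2) ≥ (7 / 10) √c`, and subtracting `ε ≤ √c / 10` leaves more than `√c / 2 = √(c / 4)`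
  have h1 : 7 / 10 * √c * ‖v‖ ≤ ‖G v‖ := by
    refine le_of_sq_le_sq ?_ (norm_nonneg _)
    rw [mul_pow, mul_pow, Real.sq_sqrt hc.le]
    refine le_trans ?_ (h.le_norm_gradOp v)
    have : 0 ≤ c * ‖v‖ ^ 2 := by positivity
    linarith
  have h2 : ‖G v‖ - ‖gradOp a x s v‖ ≤ ε * ‖v‖ := by
    refine (norm_sub_norm_le _ _).trans ?_
    rw [norm_sub_rev, ← sub_apply]
    exact (le_opNorm _ _).trans (by gcongr)
  have h3 : ε * ‖v‖ ≤ 1 / 10 * √c * ‖v‖ := by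
    gcongr
    linarith [h.ε_le]
  have h4 : 1 / 2 * √c * ‖v‖ ≤ ‖gradOp a x s v‖ := by
    have : 0 ≤ √c * ‖v‖ := by positivity
    linarith
  calc c / 4 * ‖v‖ ^ 2 = (1 / 2 * √c * ‖v‖) ^ 2 := by
        rw [mul_pow, mul_pow, Real.sq_sqrt hc.le]; ring
    _ ≤ _ := by gcongr

variable {w : ℝ → Weights m d}

/-- While the neurons are close to their initial positions, the residual decays like `e^{-ct/4}`. -/
lemma norm_residual_flow_le (h : GoodInit a x y w₀ D c U R ε) (hw : IsGradientFlow a x y w₀ w)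
    {T : ℝ} (hT : 0 ≤ T) (hR : ∀ t ∈ Set.Ico 0 T, ∀ k, ‖neuron (w t) k - neuron w₀ k‖ ≤ R) :
    ‖residual a x y (w T)‖ ≤ U * Real.exp (-(c / 4) * T) := by
  have hc : 0 < c / 4 := by linarith [h.c_pos]
  have key := norm_le_exp_mul_norm_add (z := fun t => residual a x y (w t)) hT hc le_rfl
    (hw.2.1 T hT).residual (by
      filter_upwards [hw.ae_hasDerivAt hT] with t ht hmem
      obtain ⟨s, hs, -, hu⟩ := ht hmem
      refine ⟨_, hu, ?_⟩
      rw [inner_neg_right, adjoint_inner_right, real_inner_self_eq_norm_sq]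
      have := h.le_norm_gradOp_of_close (norm_gradOp_sub_le h.D_nonneg h.sign_sq
        h.norm_augment_sq h.ε_nonneg h.count_le (hR t (Set.Ioo_subset_Ico_self hmem)) hs)
        (residual a x y (w t))
      linarith)
  simp only [zero_div, add_zero, hw.1] at key
  calc _ ≤ _ := key
    _ ≤ Real.exp (-(c / 4 * T)) * U := by gcongr; exact h.norm_residual_le
    _ = _ := by rw [mul_comm, neg_mul]

/-- Lazy training: no neuron ever moves by `R`. -/
lemma norm_neuron_sub_lt (h : GoodInit a x y w₀ D c U R ε) (hw : IsGradientFlow a x y w₀ w)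
    {t : ℝ} (ht : 0 ≤ t) (k : Fin m) : ‖neuron (w t) k - neuron w₀ k‖ < R := by
  have hRpos := h.R_pos
  have hcont : ContinuousOn w (Set.Ici 0) := by
    intro t ht
    have h1 := (hw.2.1 (t + 1) (by linarith [Set.mem_Ici.1 ht])).continuousOn
    rw [Set.uIcc_of_le (by linarith [Set.mem_Ici.1 ht])] at h1
    have h2 := h1 t ⟨ht, by linarith⟩
    rw [← Set.Ici_inter_Iic] at h2
    exact (continuousWithinAt_inter (Iic_mem_nhds (by linarith))).1 h2
  have hcont' : ContinuousOn (fun t k => neuron (w t) k - neuron w₀ k) (Set.Ici 0) :=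
    continuousOn_pi.2 fun k =>
      ((neuronCLM (d := d) k).continuous.comp_continuousOn hcont).sub continuousOn_const
  refine (pi_norm_lt_iff hRpos).1 (lt_of_forall_lt_imp_lt (R := R) hcont'.norm ?_ t ht) k
  intro T hT hprev
  have hprev' : ∀ t ∈ Set.Ico 0 T, ∀ k, ‖neuron (w t) k - neuron w₀ k‖ ≤ R :=
    fun t ht k => ((pi_norm_lt_iff hRpos).1 (hprev t ht) k).le
  refine (pi_norm_lt_iff hRpos).2 fun k => lt_of_le_of_lt ?_ h.lt_R
  have hc : 0 < c / 4 := by linarith [h.c_pos]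
  have hU := h.U_nonneg
  have key := norm_sub_le_of_deriv_le_exp (g := fun t => neuronCLM k (w t)) hT
    (K := √(n * D / m) * U) (by positivity) hc
    ((hw.2.1 T hT).lipschitz_comp (neuronCLM k).lipschitz) (by
      filter_upwards [hw.ae_hasDerivAt hT] with t ht hmem
      obtain ⟨s, hs, hwt, -⟩ := ht hmem
      refine ⟨_, (neuronCLM k).hasFDerivAt.comp_hasDerivAt t hwt, ?_⟩
      rw [map_neg, norm_neg, neuronCLM_apply, mul_assoc]
      refine (norm_neuron_gradOp_le h.sign_sq h.norm_augment_sq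
        (fun i k => abs_le_one_of_mem_reluSubderiv (hs i k)) _ k).trans ?_
      gcongr
      exact h.norm_residual_flow_le hw hmem.1.le fun τ hτ =>
        hprev' τ ⟨hτ.1, hτ.2.trans hmem.2⟩)
  simpa [hw.1] using key

lemma norm_residual_le_exp (h : GoodInit a x y w₀ D c U R ε) (hw : IsGradientFlow a x y w₀ w)
    {t : ℝ} (ht : 0 ≤ t) : ‖residual a x y (w t)‖ ≤ U * Real.exp (-(c / 4) * t) :=
  h.norm_residual_flow_le hw ht fun _ hτ k => (h.norm_neuron_sub_lt hw hτ.1 k).le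

lemma norm_gradOp_sub_le_of_flow (h : GoodInit a x y w₀ D c U R ε)
    (hw : IsGradientFlow a x y w₀ w) {t : ℝ} (ht : 0 ≤ t) {s : Fin n → Fin m → ℝ}
    (hs : ∀ i k, s i k ∈ reluSubderiv ⟪neuron (w t) k, augment (x i)⟫_ℝ) :
    ‖gradOp a x s - gradOp a x (pattern x w₀)‖ ≤ ε :=
  norm_gradOp_sub_le h.D_nonneg h.sign_sq h.norm_augment_sq h.ε_nonneg h.count_le
    (fun k => (h.norm_neuron_sub_lt hw ht k).le) hs

lemma norm_weights_sub_le (h : GoodInit a x y w₀ D c U R ε) (hw : IsGradientFlow a x y w₀ w)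
    {t : ℝ} (ht : 0 ≤ t) : ‖w t - w₀‖ ≤ √(n * D) * U / (c / 4) := by
  have hU := h.U_nonneg
  rw [← hw.1]
  refine norm_sub_le_of_deriv_le_exp ht (by positivity) (by linarith [h.c_pos]) (hw.2.1 t ht) ?_
  filter_upwards [hw.ae_hasDerivAt ht] with τ hτ hmem
  obtain ⟨s, hs, hwt, -⟩ := hτ hmem
  refine ⟨_, hwt, ?_⟩
  rw [norm_neg, mul_assoc]
  refine (le_opNorm _ _).trans ?_
  gcongr
  · exact norm_gradOp_le_of_abs_le_one h.m_pos h.D_nonneg h.sign_sq h.norm_augment_sq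
      fun i k => abs_le_one_of_mem_reluSubderiv (hs i k)
  · exact h.norm_residual_le_exp hw hmem.1.le

/-- The component of the displacement orthogonal to the initial gradients only grows through the
change of the gradients. -/
lemma norm_orthogonal_component_le (h : GoodInit a x y w₀ D c U R ε)
    (hw : IsGradientFlow a x y w₀ w) {t : ℝ} (ht : 0 ≤ t) :
    ‖(LinearMap.range (gradOp a x (pattern x w₀)).toLinearMap)ᗮ.starProjection (w t - w₀)‖ ≤
      ε * U / (c / 4) := by
  have hU := h.U_nonneg
  have hε := h.ε_nonneg
  set Q := (LinearMap.range (gradOp a x (pattern x w₀)).toLinearMap)ᗮ.starProjection with hQ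
  rw [map_sub, ← hw.1]
  refine norm_sub_le_of_deriv_le_exp (g := fun t => Q (w t)) ht (by positivity)
    (by linarith [h.c_pos]) ((hw.2.1 t ht).lipschitz_comp Q.lipschitz) ?_
  filter_upwards [hw.ae_hasDerivAt ht] with τ hτ hmem
  obtain ⟨s, hs, hwt, -⟩ := hτ hmem
  refine ⟨_, Q.hasFDerivAt.comp_hasDerivAt τ hwt, ?_⟩
  set u := residual a x y (w τ)
  have h0 : Q (gradOp a x (pattern x w₀) u) = 0 :=
    Submodule.starProjection_orthogonal_apply_eq_zero (LinearMap.mem_range_self _ u)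
  have h1 : Q (gradOp a x s u) = Q ((gradOp a x s - gradOp a x (pattern x w₀)) u) := by
    rw [sub_apply, map_sub, h0, sub_zero]
  rw [map_neg, norm_neg, h1, mul_assoc]
  refine (Submodule.norm_starProjection_apply_le _ _).trans ((le_opNorm _ _).trans ?_)
  gcongr
  · exact h.norm_gradOp_sub_le_of_flow hw hmem.1.le hs
  · exact h.norm_residual_le_exp hw hmem.1.le

/-- The component of `w - w_L` in the span of the initial gradients decays like `e^{-ct/2}`, up to
the effect of the change of the gradients. -/
lemma norm_span_component_le (h : GoodInit a x y w₀ D c U R ε)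
    (hw : IsGradientFlow a x y w₀ w) {wL : Weights m d}
    (hwL : adjoint (gradOp a x (pattern x w₀)) (wL - w₀) = -residual a x y w₀)
    {t : ℝ} (ht : 0 ≤ t) :
    ‖(LinearMap.range (gradOp a x (pattern x w₀)).toLinearMap).starProjection (w t - wL)‖ ≤
      Real.exp (-(c / 2 * t)) * ‖w 0 - wL‖ + ε * U * (4 * (n * D) / c + 1) / (c / 2) := by
  have hU := h.U_nonneg
  have hε := h.ε_nonneg
  have hc := h.c_pos
  have hD := h.D_nonneg
  set G := gradOp a x (pattern x w₀) with hG
  set V := LinearMap.range G.toLinearMap with hV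
  have hGV : ∀ v, G v ∈ V := fun v => LinearMap.mem_range_self _ v
  have hPG : ∀ v, V.starProjection (G v) = G v := fun v =>
    Submodule.starProjection_eq_self_iff.2 (hGV v)
  -- `Gᵀ` vanishes on the orthogonal complement of the range of `G`
  have hadj : ∀ v, adjoint G (V.starProjection v) = adjoint G v := fun v => by
    refine ext_inner_left ℝ fun b => ?_
    rw [adjoint_inner_right, adjoint_inner_right,
      ← Submodule.inner_starProjection_left_eq_right, hPG]
  have key := norm_le_exp_mul_norm_add (z := fun t => V.starProjection (w t - wL)) (lam := c / 2)
    (η := ε * U * (4 * (n * D) / c + 1)) ht (by linarith) (by positivity)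
    (((hw.2.1 t ht).lipschitz_comp (LipschitzWith.id.sub (LipschitzWith.const wL))).lipschitz_comp
      V.starProjection.lipschitz) (by
      filter_upwards [hw.ae_hasDerivAt ht] with τ hτ hmem
      obtain ⟨s, hs, hwt, -⟩ := hτ hmem
      refine ⟨_, V.starProjection.hasFDerivAt.comp_hasDerivAt τ (hwt.sub_const wL), ?_⟩
      set u := residual a x y (w τ) with hu
      set z := V.starProjection (w τ - wL) with hz
      set r := u - (residual a x y w₀ + adjoint G (w τ - w₀)) with hr
      set e := V.starProjection ((gradOp a x s - G) u) with he
      have hzV : ∃ v, G v = z := Submodule.starProjection_apply_mem V (w τ - wL)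
      -- the residual of the linearization at `w` is `Gᵀ (w - wL) = Gᵀ z`
      have hu' : u = adjoint G z + r := by
        rw [hz, hadj, hr, show w τ - wL = (w τ - w₀) - (wL - w₀) by abel, map_sub, hwL]
        abel
      have hder : V.starProjection (-gradOp a x s u) = -(G u + e) := by
        rw [map_neg, he, sub_apply, map_sub, hPG]; abel_nf
      have hr_le : ‖r‖ ≤ ε * (√(n * D) * U / (c / 4)) := by
        refine (norm_residual_sub_linearization_le hD h.sign_sq h.norm_augment_sq y hε h.count_le
          fun k => (h.norm_neuron_sub_lt hw hmem.1.le k).le).trans ?_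
        gcongr
        exact h.norm_weights_sub_le hw hmem.1.le
      have hu_le : ‖u‖ ≤ U := by
        refine (h.norm_residual_le_exp hw hmem.1.le).trans (mul_le_of_le_one_right hU ?_)
        rw [Real.exp_le_one_iff]
        nlinarith [hmem.1]
      have he_le : ‖e‖ ≤ ε * U := by
        refine (Submodule.norm_starProjection_apply_le _ _).trans ((le_opNorm _ _).trans ?_)
        gcongr
        exact h.norm_gradOp_sub_le_of_flow hw hmem.1.le hs
      have hGz : c / 2 * ‖z‖ ^ 2 ≤ ‖adjoint G z‖ ^ 2 := by
        obtain ⟨v, hv⟩ := hzV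
        rw [← hv]
        exact mul_norm_sq_le_norm_adjoint_sq (by linarith) h.le_norm_gradOp v
      have hGz' : ‖adjoint G z‖ ≤ √(n * D) * ‖z‖ := by
        refine (le_opNorm _ _).trans ?_
        rw [LinearIsometryEquiv.norm_map]
        gcongr
        refine norm_gradOp_le_of_abs_le_one h.m_pos hD h.sign_sq h.norm_augment_sq fun i k => ?_
        unfold pattern reluDeriv
        split_ifs <;> simp
      have hinner : ⟪z, V.starProjection (-gradOp a x s u)⟫_ℝ =
          -‖adjoint G z‖ ^ 2 - ⟪adjoint G z, r⟫_ℝ - ⟪z, e⟫_ℝ := by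
        have h1 : ⟪adjoint G z, u⟫_ℝ = ⟪adjoint G z, adjoint G z + r⟫_ℝ := congrArg _ hu'
        rw [hder, inner_neg_right, inner_add_right, ← adjoint_inner_left, h1, inner_add_right,
          real_inner_self_eq_norm_sq]
        ring
      have hi1 : -⟪adjoint G z, r⟫_ℝ ≤ √(n * D) * ‖z‖ * (ε * (√(n * D) * U / (c / 4))) := by
        refine (neg_le_abs _).trans ((abs_real_inner_le_norm _ _).trans ?_)
        gcongr
      have hi2 : -⟪z, e⟫_ℝ ≤ ‖z‖ * (ε * U) := by
        refine (neg_le_abs _).trans ((abs_real_inner_le_norm _ _).trans ?_)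
        gcongr
      have hsq : √(n * D) * ‖z‖ * (ε * (√(n * D) * U / (c / 4))) =
          ε * U * (4 * (n * D) / c) * ‖z‖ := by
        have : √(n * D) * √(n * D) = n * D := Real.mul_self_sqrt (by positivity)
        calc _ = (√(n * D) * √(n * D)) * (ε * U * ‖z‖ / (c / 4)) := by ring
          _ = _ := by rw [this]; field_simp
      refine hinner.le.trans ?_
      rw [hsq] at hi1
      linarith)
  refine key.trans ?_
  gcongr
  exact Submodule.norm_starProjection_apply_le _ _

/-- From a good initialization the minimum-norm interpolant exists, and gradient flow converges to
within `O(n D ε U / c²)` of it. -/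
theorem exists_isMinNormInterpolant (h : GoodInit a x y w₀ D c U R ε) (hcn : c ≤ n * D) :
    ∃ wL, IsMinNormInterpolant a w₀ x y wL ∧ ∀ w, IsGradientFlow a x y w₀ w → ∀ t, 0 ≤ t →
      ‖w t - wL‖ ≤ Real.exp (-(c * t / 2)) * ‖w 0 - wL‖ + 14 * (n * D * (ε * U) / c ^ 2) := by
  have hU := h.U_nonneg
  have hε := h.ε_nonneg
  have hc := h.c_pos
  obtain ⟨v, hv⟩ := exists_adjoint_apply_eq (half_pos hc) h.le_norm_gradOp (-residual a x y w₀)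
  refine ⟨_, isMinNormInterpolant_add hv, fun w hw t ht => ?_⟩
  set G := gradOp a x (pattern x w₀) with hG
  set V := LinearMap.range G.toLinearMap with hV
  have h1 := h.norm_span_component_le hw (wL := w₀ + G v)
    (by rw [add_sub_cancel_left, ← hG, hv]) ht
  have h2 := h.norm_orthogonal_component_le hw ht
  have h3 : Vᗮ.starProjection (w t - (w₀ + G v)) = Vᗮ.starProjection (w t - w₀) := by
    have hmem : G v ∈ V := LinearMap.mem_range_self _ v
    rw [← sub_sub, map_sub, Submodule.starProjection_orthogonal_apply_eq_zero hmem, sub_zero]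
  change ‖V.starProjection (w t - (w₀ + G v))‖ ≤ _ at h1
  change ‖Vᗮ.starProjection (w t - w₀)‖ ≤ _ at h2
  rw [← h3] at h2
  have h4 := norm_add_le (V.starProjection (w t - (w₀ + G v)))
    (Vᗮ.starProjection (w t - (w₀ + G v)))
  rw [Submodule.starProjection_add_starProjection_orthogonal] at h4
  have h5 : ε * U * (4 * (n * D) / c + 1) / (c / 2) + ε * U / (c / 4) ≤
      14 * (n * D * (ε * U) / c ^ 2) := by
    have : 14 * (n * D * (ε * U) / c ^ 2) -
        (ε * U * (4 * (n * D) / c + 1) / (c / 2) + ε * U / (c / 4)) =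
        6 * (ε * U) * (n * D - c) / c ^ 2 := by
      field_simp; ring
    have h6 : 0 ≤ 6 * (ε * U) * (n * D - c) / c ^ 2 := by
      have := sub_nonneg.2 hcn
      positivity
    linarith
  have h7 : -(c / 2 * t) = -(c * t / 2) := by ring
  rw [h7] at h1
  linarith

end GoodInit

/-! ### Random signs and Gaussian preactivations -/

instance : IsProbabilityMeasure signMeasure :=
  ⟨by simp [signMeasure, ENNReal.inv_two_add_inv_two]⟩

instance : IsProbabilityMeasure (initMeasure m d) := by
  unfold initMeasure; infer_instance

lemma ae_signMeasure : ∀ᵐ b ∂signMeasure, b ^ 2 = 1 := by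
  have h : ∀ c : ℝ, c ^ 2 = 1 → ∀ᵐ b ∂((2⁻¹ : ENNReal) • Measure.dirac c), b ^ 2 = 1 := by
    intro c hc
    refine Measure.ae_smul_measure ?_ _
    rw [ae_dirac_eq]
    exact hc
  exact ae_add_measure_iff.2 ⟨h 1 (by norm_num), h (-1) (by norm_num)⟩

lemma integral_signMeasure (f : ℝ → ℝ) : ∫ b, f b ∂signMeasure = (f 1 + f (-1)) / 2 := by
  have h : ∀ c : ℝ, Integrable f ((2⁻¹ : ENNReal) • Measure.dirac c) := fun c =>
    (integrable_dirac (by simp)).smul_measure (by simp)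
  rw [signMeasure, integral_add_measure (h 1) (h (-1)), integral_smul_measure,
    integral_smul_measure, integral_dirac, integral_dirac]
  simp
  ring

lemma memLp_signMeasure : MemLp id 2 signMeasure := by
  refine MemLp.of_bound (C := 1) (by fun_prop) ?_
  filter_upwards [ae_signMeasure] with b hb
  rw [Real.norm_eq_abs]
  exact (sq_le_one_iff_abs_le_one _).1 hb.le

lemma ae_initMeasure_sq_eq_one : ∀ᵐ p ∂initMeasure m d, ∀ k, p.2 k ^ 2 = 1 := by
  have h : ∀ᵐ a ∂(Measure.pi fun _ : Fin m => signMeasure), ∀ k, a k ^ 2 = 1 :=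
    ae_all_iff.2 fun k =>
      (measurePreserving_eval (fun _ : Fin m => signMeasure) k).quasiMeasurePreserving.ae
        ae_signMeasure
  exact Measure.quasiMeasurePreserving_snd.ae h

/-- The second moment of a Rademacher sum. -/
lemma lintegral_sq_sum_sign (b : Fin m → ℝ) :
    ∫⁻ a, ENNReal.ofReal ((∑ k, a k * b k) ^ 2) ∂(Measure.pi fun _ : Fin m => signMeasure) =
      ENNReal.ofReal (∑ k, b k ^ 2) := by
  have hL : ∀ k, MemLp (fun c : ℝ => b k * id c) 2 signMeasure := fun k =>
    memLp_signMeasure.const_mul (b k)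
  have hvar := variance_sum_pi (X := fun k c => b k * id c) hL
  have hsum : (∑ k, fun a : Fin m → ℝ => b k * id (a k)) = fun a => ∑ k, a k * b k := by
    ext a; simp [mul_comm]
  have hmem : MemLp (fun a : Fin m → ℝ => ∑ k, a k * b k) 2
      (Measure.pi fun _ : Fin m => signMeasure) := by
    rw [← hsum]
    exact memLp_finsetSum' _ fun k _ => (hL k).comp_measurePreserving (measurePreserving_eval _ k)
  have hmean : ∫ a, ∑ k, a k * b k ∂(Measure.pi fun _ : Fin m => signMeasure) = 0 := by
    rw [integral_finsetSum]
    · refine Finset.sum_eq_zero fun k _ => ?_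
      rw [integral_comp_eval (μ := fun _ : Fin m => signMeasure) (i := k)
        (f := fun c : ℝ => c * b k) (by fun_prop), integral_signMeasure]
      ring
    · intro k _
      have := ((hL k).comp_measurePreserving
        (measurePreserving_eval (fun _ : Fin m => signMeasure) k)).integrable (by norm_num)
      simpa [Function.comp_def, mul_comm] using this
  have h1 := evariance_eq_lintegral_ofReal (fun a : Fin m → ℝ => ∑ k, a k * b k)
    (Measure.pi fun _ : Fin m => signMeasure)
  rw [hmean, ← ofReal_variance hmem] at h1
  simp only [sub_zero] at h1
  rw [← h1, ← hsum, hvar]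
  congr 1
  refine Finset.sum_congr rfl fun k _ => ?_
  rw [variance_eq_integral (by fun_prop), integral_signMeasure, integral_signMeasure]
  simp

lemma map_inner_stdGaussian {ι : Type*} [Fintype ι] (v : EuclideanSpace ℝ ι) :
    (stdGaussian (EuclideanSpace ℝ ι)).map (fun g => ⟪g, v⟫_ℝ) =
      gaussianReal 0 (‖v‖ ^ 2).toNNReal := by
  have h := IsGaussian.map_eq_gaussianReal (μ := stdGaussian (EuclideanSpace ℝ ι)) (innerSL ℝ v)
  rw [integral_strongDual_stdGaussian, variance_dual_stdGaussian, innerSL_apply_norm] at h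
  rw [← h]
  congr 1
  ext g
  simp [real_inner_comm]

lemma lintegral_inner_sq_stdGaussian {ι : Type*} [Fintype ι] (v : EuclideanSpace ℝ ι) :
    ∫⁻ g, ENNReal.ofReal (⟪g, v⟫_ℝ ^ 2) ∂stdGaussian (EuclideanSpace ℝ ι) =
      ENNReal.ofReal (‖v‖ ^ 2) := by
  have h := lintegral_map (μ := stdGaussian (EuclideanSpace ℝ ι))
    (f := fun z : ℝ => ENNReal.ofReal (z ^ 2)) (g := fun g => ⟪g, v⟫_ℝ)
    (by fun_prop) (by fun_prop)
  rw [← h, map_inner_stdGaussian]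
  have h1 := evariance_eq_lintegral_ofReal (id : ℝ → ℝ) (gaussianReal 0 (‖v‖ ^ 2).toNNReal)
  simp only [id, integral_id_gaussianReal, sub_zero] at h1
  rw [← h1]
  have h2 := ofReal_variance (memLp_id_gaussianReal' (μ := 0) (v := (‖v‖ ^ 2).toNNReal) 2 (by simp))
  rw [variance_id_gaussianReal, Real.coe_toNNReal _ (by positivity)] at h2
  exact h2.symm

/-- Anti-concentration of a Gaussian preactivation, from the bound on its density. -/
lemma stdGaussian_abs_inner_le {ι : Type*} [Fintype ι] {v : EuclideanSpace ℝ ι} (hv : v ≠ 0)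
    (R : ℝ) :
    stdGaussian (EuclideanSpace ℝ ι) {g | |⟪g, v⟫_ℝ| ≤ R * ‖v‖} ≤ ENNReal.ofReal R := by
  have hv' : 0 < ‖v‖ := norm_pos_iff.2 hv
  have hmeas : MeasurableSet {z : ℝ | |z| ≤ R * ‖v‖} :=
    measurableSet_le (by fun_prop) (by fun_prop)
  have h1 : stdGaussian (EuclideanSpace ℝ ι) {g | |⟪g, v⟫_ℝ| ≤ R * ‖v‖} =
      gaussianReal 0 (‖v‖ ^ 2).toNNReal {z | |z| ≤ R * ‖v‖} := by
    rw [← map_inner_stdGaussian, Measure.map_apply (by fun_prop) hmeas]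
    rfl
  have hne : (‖v‖ ^ 2).toNNReal ≠ 0 := by
    rw [Ne, Real.toNNReal_eq_zero, not_le]; positivity
  rw [h1, gaussianReal_apply _ hne]
  have hpdf : ∀ z, gaussianPDF 0 (‖v‖ ^ 2).toNNReal z ≤ ENNReal.ofReal ((2 * ‖v‖)⁻¹) := by
    intro z
    rw [gaussianPDF]
    refine ENNReal.ofReal_le_ofReal ?_
    rw [gaussianPDFReal, Real.coe_toNNReal _ (by positivity)]
    have he : Real.exp (-(z - 0) ^ 2 / (2 * ‖v‖ ^ 2)) ≤ 1 := by
      rw [Real.exp_le_one_iff, neg_div, neg_nonpos]; positivity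
    refine (mul_le_of_le_one_right (by positivity) he).trans ?_
    -- the density is at most `1 / √(2π ‖v‖²)`, and `2π ≥ 4`
    refine inv_anti₀ (by positivity) (Real.le_sqrt_of_sq_le ?_)
    have := Real.pi_gt_three
    nlinarith [sq_nonneg ‖v‖]
  calc ∫⁻ z in {z | |z| ≤ R * ‖v‖}, gaussianPDF 0 (‖v‖ ^ 2).toNNReal z
      ≤ ∫⁻ z in {z | |z| ≤ R * ‖v‖}, ENNReal.ofReal ((2 * ‖v‖)⁻¹) := lintegral_mono hpdf
    _ = ENNReal.ofReal ((2 * ‖v‖)⁻¹) * volume {z : ℝ | |z| ≤ R * ‖v‖} := by simp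
    _ = ENNReal.ofReal ((2 * ‖v‖)⁻¹) * ENNReal.ofReal (2 * (R * ‖v‖)) := by
        have : {z : ℝ | |z| ≤ R * ‖v‖} = Set.Icc (-(R * ‖v‖)) (R * ‖v‖) := by
          ext z
          rw [Set.mem_ofPred_eq, abs_le, Set.mem_Icc]
        rw [this, Real.volume_Icc]
        congr 2
        ring
    _ = ENNReal.ofReal R := by
        rw [← ENNReal.ofReal_mul (by positivity)]
        congr 1
        field_simp

/-! ### The three random quantities -/

lemma measurable_reluDeriv : Measurable reluDeriv :=
  Measurable.ite measurableSet_Ici measurable_const measurable_const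

lemma norm_augment_sq_eq {x : EuclideanSpace ℝ (Fin d)} (hx : ‖x‖ = √d) :
    ‖augment x‖ ^ 2 = d + 1 := by
  have h : ‖augment x‖ ^ 2 = ‖x‖ ^ 2 + 1 := by
    rw [EuclideanSpace.real_norm_sq_eq, EuclideanSpace.real_norm_sq_eq, Fin.sum_univ_castSucc]
    simp [augment]
  rw [h, hx, Real.sq_sqrt (Nat.cast_nonneg _)]

lemma augment_injective : Function.Injective (augment : EuclideanSpace ℝ (Fin d) → _) := by
  intro x x' h
  ext j
  have := congrArg (fun v : EuclideanSpace ℝ (Fin (d + 1)) => v j.castSucc) h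
  simpa [augment] using this

lemma augment_ne_zero (x : EuclideanSpace ℝ (Fin d)) : augment x ≠ 0 := by
  intro h
  have := congrArg (fun v : EuclideanSpace ℝ (Fin (d + 1)) => v (Fin.last d)) h
  simp [augment] at this

lemma measurable_net (x : EuclideanSpace ℝ (Fin d)) :
    Measurable fun p : (Fin m → EuclideanSpace ℝ (Fin (d + 1))) × (Fin m → ℝ) =>
      net p.2 x (assemble p.1) := by
  simp only [net, neuron_assemble, relu]
  fun_prop

/-- The network at initialization has second moment at most `‖x̃‖²`: the independent signs remove
the correlations between the neurons. -/
lemma lintegral_net_sq_le (x : EuclideanSpace ℝ (Fin d)) :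
    ∫⁻ p, ENNReal.ofReal (net p.2 x (assemble p.1) ^ 2) ∂initMeasure m d ≤
      ENNReal.ofReal (‖augment x‖ ^ 2) := by
  rw [initMeasure, lintegral_prod _
    (((measurable_net x).pow_const 2).ennreal_ofReal.aemeasurable)]
  have hin : ∀ W : Fin m → EuclideanSpace ℝ (Fin (d + 1)),
      ∫⁻ a, ENNReal.ofReal (net a x (assemble W) ^ 2)
        ∂(Measure.pi fun _ : Fin m => signMeasure) ≤
      ∑ k, ENNReal.ofReal (1 / m) * ENNReal.ofReal (⟪W k, augment x⟫_ℝ ^ 2) := by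
    intro W
    have h := lintegral_sq_sum_sign fun k => relu ⟪W k, augment x⟫_ℝ / √m
    have h2 : ∀ a : Fin m → ℝ, net a x (assemble W) =
        ∑ k, a k * (relu ⟪W k, augment x⟫_ℝ / √m) := fun a =>
      Finset.sum_congr rfl fun k _ => by rw [neuron_assemble]; ring
    simp only [h2, h]
    rw [ENNReal.ofReal_sum_of_nonneg fun k _ => by positivity]
    refine Finset.sum_le_sum fun k _ => ?_
    rw [← ENNReal.ofReal_mul (by positivity)]
    refine ENNReal.ofReal_le_ofReal ?_
    rw [div_pow, Real.sq_sqrt (Nat.cast_nonneg _), div_eq_mul_one_div, mul_comm]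
    refine mul_le_mul_of_nonneg_left ?_ (by positivity)
    rw [relu]
    rcases le_total 0 ⟪W k, augment x⟫_ℝ with h | h
    · rw [max_eq_right h]
    · rw [max_eq_left h, zero_pow two_ne_zero]; positivity
  refine (lintegral_mono hin).trans ?_
  rw [lintegral_finsetSum _ fun k _ => by fun_prop]
  have hk : ∀ k : Fin m, ∫⁻ W, ENNReal.ofReal (1 / m) * ENNReal.ofReal (⟪W k, augment x⟫_ℝ ^ 2)
      ∂(Measure.pi fun _ : Fin m => stdGaussian (EuclideanSpace ℝ (Fin (d + 1)))) =
      ENNReal.ofReal (1 / m) * ENNReal.ofReal (‖augment x‖ ^ 2) := by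
    intro k
    rw [lintegral_const_mul _ (by fun_prop), ← lintegral_inner_sq_stdGaussian]
    congr 1
    exact (measurePreserving_eval (fun _ : Fin m => stdGaussian (EuclideanSpace ℝ (Fin (d + 1))))
      k).lintegral_comp (f := fun g => ENNReal.ofReal (⟪g, augment x⟫_ℝ ^ 2)) (by fun_prop)
  simp only [hk, Finset.sum_const, Finset.card_univ, Fintype.card_fin, nsmul_eq_mul]
  rcases Nat.eq_zero_or_pos m with rfl | hm
  · simp
  · rw [← mul_assoc, ← ENNReal.ofReal_natCast, ← ENNReal.ofReal_mul (by positivity),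
      mul_one_div_cancel (by positivity)]
    simp

lemma measurable_nearKinkCount (x : Fin n → EuclideanSpace ℝ (Fin d)) (r : ℝ) :
    Measurable fun p : (Fin m → EuclideanSpace ℝ (Fin (d + 1))) × (Fin m → ℝ) =>
      nearKinkCount x (assemble p.1) r := by
  unfold nearKinkCount
  simp only [neuron_assemble]
  refine Finset.measurable_sum _ fun i _ => Finset.measurable_sum _ fun k _ => ?_
  exact Measurable.ite (measurableSet_le (by fun_prop) measurable_const) measurable_const
    measurable_const

/-- The expected number of preactivations of size at most `R √D` is at most `n m R`. -/
lemma lintegral_nearKinkCount_le (x : Fin n → EuclideanSpace ℝ (Fin d)) {D R : ℝ}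
    (hx : ∀ i, ‖augment (x i)‖ ^ 2 = D) :
    ∫⁻ p, ENNReal.ofReal (nearKinkCount x (assemble p.1) (R * √D)) ∂initMeasure m d ≤
      ENNReal.ofReal (n * m * R) := by
  have hset : ∀ i, MeasurableSet
      {g : EuclideanSpace ℝ (Fin (d + 1)) | |⟪g, augment (x i)⟫_ℝ| ≤ R * √D} := fun i =>
    measurableSet_le (by fun_prop) measurable_const
  have h : ∀ p : (Fin m → EuclideanSpace ℝ (Fin (d + 1))) × (Fin m → ℝ),
      ENNReal.ofReal (nearKinkCount x (assemble p.1) (R * √D)) =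
      ∑ i, ∑ k, {g | |⟪g, augment (x i)⟫_ℝ| ≤ R * √D}.indicator 1 (p.1 k) := by
    intro p
    rw [nearKinkCount, ENNReal.ofReal_sum_of_nonneg
      fun i _ => Finset.sum_nonneg fun k _ => by split_ifs <;> norm_num]
    refine Finset.sum_congr rfl fun i _ => ?_
    rw [ENNReal.ofReal_sum_of_nonneg fun k _ => by split_ifs <;> norm_num]
    refine Finset.sum_congr rfl fun k _ => ?_
    rw [neuron_assemble]
    by_cases hk : |⟪p.1 k, augment (x i)⟫_ℝ| ≤ R * √D
    · rw [if_pos hk, Set.indicator_of_mem (Set.mem_ofPred_eq ▸ hk)]; simp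
    · rw [if_neg hk, Set.indicator_of_notMem (Set.mem_ofPred_eq ▸ hk)]; simp
  have hmeas : ∀ i, Measurable ({g : EuclideanSpace ℝ (Fin (d + 1)) |
      |⟪g, augment (x i)⟫_ℝ| ≤ R * √D}.indicator
        (1 : EuclideanSpace ℝ (Fin (d + 1)) → ENNReal)) := fun i =>
    measurable_one.indicator (hset i)
  have hmeas' : ∀ i k, Measurable fun p : (Fin m → EuclideanSpace ℝ (Fin (d + 1))) × (Fin m → ℝ) =>
      {g | |⟪g, augment (x i)⟫_ℝ| ≤ R * √D}.indicator
        (1 : EuclideanSpace ℝ (Fin (d + 1)) → ENNReal) (p.1 k) := fun i k =>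
    (hmeas i).comp ((measurable_pi_apply k).comp measurable_fst)
  simp only [h]
  rw [lintegral_finsetSum _ fun i _ => Finset.measurable_sum _ fun k _ => hmeas' i k]
  simp only [lintegral_finsetSum _ fun k _ => hmeas' _ k]
  have hik : ∀ i k, ∫⁻ p, {g | |⟪g, augment (x i)⟫_ℝ| ≤ R * √D}.indicator
      (1 : EuclideanSpace ℝ (Fin (d + 1)) → ENNReal) (p.1 k) ∂initMeasure m d ≤
      ENNReal.ofReal R := by
    intro i k
    have hmp : MeasurePreserving
        (fun p : (Fin m → EuclideanSpace ℝ (Fin (d + 1))) × (Fin m → ℝ) => p.1 k)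
        (initMeasure m d) (stdGaussian (EuclideanSpace ℝ (Fin (d + 1)))) :=
      (measurePreserving_eval (fun _ : Fin m => stdGaussian (EuclideanSpace ℝ (Fin (d + 1))))
        k).comp measurePreserving_fst
    rw [hmp.lintegral_comp (hmeas i), lintegral_indicator_one (hset i), ← hx i,
      Real.sqrt_sq (norm_nonneg _)]
    exact stdGaussian_abs_inner_le (augment_ne_zero _) R
  calc _ ≤ ∑ i : Fin n, ∑ k : Fin m, ENNReal.ofReal R :=
        Finset.sum_le_sum fun i _ => Finset.sum_le_sum fun k _ => hik i k
    _ = ENNReal.ofReal (n * m * R) := by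
        rw [ENNReal.ofReal_mul (by positivity), ENNReal.ofReal_mul (by positivity)]
        simp [mul_assoc]

/-- The input `x̃`, multiplied by `σ'(gᵀ x̃)`: the gradient of a neuron with weight `g`. -/
def activeInput (x : EuclideanSpace ℝ (Fin d)) (g : EuclideanSpace ℝ (Fin (d + 1))) :
    EuclideanSpace ℝ (Fin (d + 1)) :=
  reluDeriv ⟪g, augment x⟫_ℝ • augment x

@[fun_prop]
lemma measurable_activeInput (x : EuclideanSpace ℝ (Fin d)) : Measurable (activeInput x) :=
  (measurable_reluDeriv.comp (by fun_prop)).smul measurable_const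

lemma norm_activeInput_le (x : EuclideanSpace ℝ (Fin d)) (g : EuclideanSpace ℝ (Fin (d + 1))) :
    ‖activeInput x g‖ ≤ ‖augment x‖ := by
  unfold activeInput reluDeriv
  split_ifs <;> simp

lemma abs_inner_activeInput_le (x x' : EuclideanSpace ℝ (Fin d))
    (g : EuclideanSpace ℝ (Fin (d + 1))) :
    |⟪activeInput x g, activeInput x' g⟫_ℝ| ≤ ‖augment x‖ * ‖augment x'‖ :=
  (abs_real_inner_le_norm _ _).trans
    (mul_le_mul (norm_activeInput_le _ _) (norm_activeInput_le _ _) (norm_nonneg _) (norm_nonneg _))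

/-- The empirical Gram matrix `∇ᵀf₀ ∇f₀`, in which the signs cancel. -/
def empiricalGram (x : Fin n → EuclideanSpace ℝ (Fin d))
    (W : Fin m → EuclideanSpace ℝ (Fin (d + 1))) (i j : Fin n) : ℝ :=
  ∑ k, ⟪activeInput (x i) (W k), activeInput (x j) (W k)⟫_ℝ / m

lemma inner_netGrad {a : Fin m → ℝ} (ha : ∀ k, a k ^ 2 = 1)
    (x : Fin n → EuclideanSpace ℝ (Fin d)) (W : Fin m → EuclideanSpace ℝ (Fin (d + 1)))
    (i j : Fin n) :
    ⟪netGrad a (x i) (assemble W), netGrad a (x j) (assemble W)⟫_ℝ = empiricalGram x W i j := by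
  rw [inner_eq_sum_neuron]
  refine Finset.sum_congr rfl fun k _ => ?_
  simp only [netGrad, gradWith, neuron_assemble, activeInput, real_inner_smul_left,
    real_inner_smul_right]
  have h : a k / √m * (a k / √m) = 1 / m := by
    rw [← pow_two, div_pow, ha, Real.sq_sqrt (Nat.cast_nonneg _)]
  linear_combination (reluDeriv ⟪W k, augment (x i)⟫_ℝ * reluDeriv ⟪W k, augment (x j)⟫_ℝ *
    ⟪augment (x i), augment (x j)⟫_ℝ) * h

lemma norm_gradOp_pattern_sq {a : Fin m → ℝ} (ha : ∀ k, a k ^ 2 = 1)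
    (x : Fin n → EuclideanSpace ℝ (Fin d)) (W : Fin m → EuclideanSpace ℝ (Fin (d + 1)))
    (v : EuclideanSpace ℝ (Fin n)) :
    ‖gradOp a x (pattern x (assemble W)) v‖ ^ 2 =
      ∑ i, ∑ j, v i * v j * empiricalGram x W i j := by
  rw [gradOp, synthesis_apply, ← real_inner_self_eq_norm_sq, sum_inner]
  refine Finset.sum_congr rfl fun i _ => ?_
  rw [inner_sum]
  refine Finset.sum_congr rfl fun j _ => ?_
  rw [real_inner_smul_left, real_inner_smul_right, ← inner_netGrad ha, ← mul_assoc]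
  rfl

lemma memLp_inner_activeInput (x x' : EuclideanSpace ℝ (Fin d)) (p : ENNReal) :
    MemLp (fun g => ⟪activeInput x g, activeInput x' g⟫_ℝ) p
      (stdGaussian (EuclideanSpace ℝ (Fin (d + 1)))) :=
  MemLp.of_bound (by fun_prop) (‖augment x‖ * ‖augment x'‖)
    (Filter.Eventually.of_forall fun g => abs_inner_activeInput_le x x' g)

lemma integral_empiricalGram (hm : 0 < m) (x : Fin n → EuclideanSpace ℝ (Fin d)) (i j : Fin n) :
    ∫ W, empiricalGram x W i j
      ∂(Measure.pi fun _ : Fin m => stdGaussian (EuclideanSpace ℝ (Fin (d + 1)))) =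
    ∫ g, ⟪activeInput (x i) g, activeInput (x j) g⟫_ℝ
      ∂stdGaussian (EuclideanSpace ℝ (Fin (d + 1))) := by
  have hm' : (m : ℝ) ≠ 0 := Nat.cast_ne_zero.2 hm.ne'
  have hL := memLp_inner_activeInput (x i) (x j)
  unfold empiricalGram
  rw [integral_finsetSum]
  · have hk : ∀ k : Fin m, ∫ W, ⟪activeInput (x i) (W k), activeInput (x j) (W k)⟫_ℝ / m
        ∂(Measure.pi fun _ : Fin m => stdGaussian (EuclideanSpace ℝ (Fin (d + 1)))) =
        (∫ g, ⟪activeInput (x i) g, activeInput (x j) g⟫_ℝ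
          ∂stdGaussian (EuclideanSpace ℝ (Fin (d + 1)))) / m := by
      intro k
      rw [integral_div]
      congr 1
      exact integral_comp_eval (i := k)
        (μ := fun _ : Fin m => stdGaussian (EuclideanSpace ℝ (Fin (d + 1))))
        (f := fun g => ⟪activeInput (x i) g, activeInput (x j) g⟫_ℝ) (hL 1).aestronglyMeasurable
    simp only [hk, Finset.sum_const, Finset.card_univ, Fintype.card_fin, nsmul_eq_mul]
    field_simp
  · intro k _
    exact (((hL 1).comp_measurePreserving
      (measurePreserving_eval _ k)).integrable le_rfl).div_const _

/-- `H` does not depend on the width: its entries are expectations over a single neuron. -/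
lemma ntkMatrix_apply (hm : 0 < m) (x : Fin n → EuclideanSpace ℝ (Fin d)) (i j : Fin n) :
    ntkMatrix m x i j = ∫ g, ⟪activeInput (x i) g, activeInput (x j) g⟫_ℝ
      ∂stdGaussian (EuclideanSpace ℝ (Fin (d + 1))) := by
  rw [ntkMatrix, Matrix.of_apply, ← integral_empiricalGram hm, initMeasure]
  rw [integral_congr_ae (g := fun p => empiricalGram x p.1 i j)]
  · rw [integral_fun_fst (fun W => empiricalGram x W i j)]
    simp
  · filter_upwards [ae_initMeasure_sq_eq_one (m := m) (d := d)] with p hp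
    exact inner_netGrad hp x p.1 i j

lemma measurable_empiricalGram (x : Fin n → EuclideanSpace ℝ (Fin d)) (i j : Fin n) :
    Measurable fun W : Fin m → EuclideanSpace ℝ (Fin (d + 1)) => empiricalGram x W i j := by
  unfold empiricalGram
  fun_prop

/-- Each entry of the empirical Gram matrix has variance at most `D² / m`. -/
lemma lintegral_sq_empiricalGram_sub_le (hm : 0 < m) {x : Fin n → EuclideanSpace ℝ (Fin d)}
    {D : ℝ} (hx : ∀ i, ‖augment (x i)‖ ^ 2 = D) (i j : Fin n) :
    ∫⁻ p, ENNReal.ofReal ((empiricalGram x p.1 i j - ntkMatrix m x i j) ^ 2) ∂initMeasure m d ≤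
      ENNReal.ofReal (D ^ 2 / m) := by
  have hm' : (0 : ℝ) < m := Nat.cast_pos.2 hm
  have hD : ‖augment (x i)‖ * ‖augment (x j)‖ = D := by
    have hij : ‖augment (x i)‖ = ‖augment (x j)‖ := by
      rw [← sq_eq_sq₀ (norm_nonneg _) (norm_nonneg _), hx, hx]
    rw [hij, ← pow_two, hx]
  set ψ : EuclideanSpace ℝ (Fin (d + 1)) → ℝ :=
    fun g => ⟪activeInput (x i) g, activeInput (x j) g⟫_ℝ / m with hψ
  have hL : MemLp ψ 2 (stdGaussian (EuclideanSpace ℝ (Fin (d + 1)))) := by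
    have := (memLp_inner_activeInput (x i) (x j) 2).const_mul (1 / (m : ℝ))
    refine this.congr_norm (by fun_prop) (Filter.Eventually.of_forall fun g => ?_)
    rw [hψ]; simp only []; congr 1; ring
  have hsum : (∑ k, fun W : Fin m → EuclideanSpace ℝ (Fin (d + 1)) => ψ (W k)) =
      fun W => empiricalGram x W i j := by
    ext W; simp [empiricalGram, ψ]
  have hmem : MemLp (fun W : Fin m → EuclideanSpace ℝ (Fin (d + 1)) => empiricalGram x W i j) 2
      (Measure.pi fun _ : Fin m => stdGaussian (EuclideanSpace ℝ (Fin (d + 1)))) := by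
    rw [← hsum]
    exact memLp_finsetSum' _ fun k _ => hL.comp_measurePreserving (measurePreserving_eval _ k)
  have hvar := variance_sum_pi (X := fun _ : Fin m => ψ) fun _ => hL
  rw [hsum] at hvar
  have hψvar : Var[ψ; stdGaussian (EuclideanSpace ℝ (Fin (d + 1)))] ≤ (D / m) ^ 2 := by
    refine (variance_le_sq_of_bounded (a := -(D / m)) (b := D / m)
      (Filter.Eventually.of_forall fun g => ?_) hL.aestronglyMeasurable.aemeasurable).trans_eq
      (by ring)
    have h1 := abs_inner_activeInput_le (x i) (x j) g
    rw [hD] at h1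
    rw [Set.mem_Icc, ← abs_le, hψ]
    simp only [abs_div, Nat.abs_cast]
    gcongr
  have hfst : ∫⁻ p, ENNReal.ofReal ((empiricalGram x p.1 i j - ntkMatrix m x i j) ^ 2)
      ∂initMeasure m d = ∫⁻ W, ENNReal.ofReal ((empiricalGram x W i j - ntkMatrix m x i j) ^ 2)
      ∂(Measure.pi fun _ : Fin m => stdGaussian (EuclideanSpace ℝ (Fin (d + 1)))) :=
    measurePreserving_fst.lintegral_comp
      (f := fun W => ENNReal.ofReal ((empiricalGram x W i j - ntkMatrix m x i j) ^ 2))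
      (((measurable_empiricalGram x i j).sub_const _).pow_const 2).ennreal_ofReal
  rw [hfst, ntkMatrix_apply hm, ← integral_empiricalGram hm, ← evariance_eq_lintegral_ofReal,
    ← ofReal_variance hmem, hvar]
  refine ENNReal.ofReal_le_ofReal ?_
  calc ∑ k : Fin m, Var[ψ; stdGaussian (EuclideanSpace ℝ (Fin (d + 1)))]
      ≤ ∑ k : Fin m, (D / m) ^ 2 := Finset.sum_le_sum fun k _ => hψvar
    _ = D ^ 2 / m := by simp; field_simp

/-! ### Positive definiteness of the expected Gram matrix -/

instance : (gaussianReal 0 1).IsOpenPosMeasure :=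
  (gaussianReal_absolutelyContinuous' 0 one_ne_zero).isOpenPosMeasure

instance {ι : Type*} [Fintype ι] : (stdGaussian (EuclideanSpace ℝ ι)).IsOpenPosMeasure := by
  rw [← map_pi_eq_stdGaussian]
  exact (PiLp.continuous_toLp 2 _).isOpenPosMeasure_map (WithLp.toLp_surjective 2)

/-- `vᵀ H v = 𝔼 ‖∑ᵢ vᵢ σ'(gᵀ x̃ᵢ) x̃ᵢ‖²`. -/
lemma dotProduct_ntkMatrix_mulVec (hm : 0 < m) (x : Fin n → EuclideanSpace ℝ (Fin d))
    (v : Fin n → ℝ) :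
    v ⬝ᵥ ((ntkMatrix m x).mulVec v) = ∫ g, ‖∑ i, v i • activeInput (x i) g‖ ^ 2
      ∂stdGaussian (EuclideanSpace ℝ (Fin (d + 1))) := by
  have hL := fun i j => (memLp_inner_activeInput (x i) (x j) 1).integrable le_rfl
  have h : ∀ g, ‖∑ i, v i • activeInput (x i) g‖ ^ 2 =
      ∑ i, ∑ j, v i * v j * ⟪activeInput (x i) g, activeInput (x j) g⟫_ℝ := by
    intro g
    rw [← real_inner_self_eq_norm_sq, sum_inner]
    refine Finset.sum_congr rfl fun i _ => ?_
    rw [inner_sum]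
    refine Finset.sum_congr rfl fun j _ => ?_
    rw [real_inner_smul_left, real_inner_smul_right]
    ring
  simp only [h]
  rw [integral_finsetSum _ fun i _ => integrable_finsetSum _ fun j _ => (hL i j).const_mul _]
  simp only [integral_finsetSum _ fun j _ => (hL _ j).const_mul _, integral_const_mul,
    ← ntkMatrix_apply hm, dotProduct, Matrix.mulVec, Finset.mul_sum]
  refine Finset.sum_congr rfl fun i _ => Finset.sum_congr rfl fun j _ => ?_
  ring

/-- There is a point of the hyperplane orthogonal to `x̃ᵢ` that lies on none of the hyperplanes
orthogonal to the other inputs. -/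
lemma exists_inner_eq_zero_of_ne {x : Fin n → EuclideanSpace ℝ (Fin d)}
    (hx : Function.Injective x) (hnorm : ∀ i j, ‖augment (x i)‖ = ‖augment (x j)‖) (i : Fin n) :
    ∃ g, ⟪g, augment (x i)⟫_ℝ = 0 ∧ ∀ j, j ≠ i → ⟪g, augment (x j)⟫_ℝ ≠ 0 := by
  classical
  set S : Submodule ℝ (EuclideanSpace ℝ (Fin (d + 1))) := (ℝ ∙ augment (x i))ᗮ with hS
  have hmemS : ∀ g, g ∈ S ↔ ⟪g, augment (x i)⟫_ℝ = 0 := fun g => by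
    rw [hS, Submodule.mem_orthogonal_singleton_iff_inner_left]
  set K : Fin n → Submodule ℝ S := fun j =>
    LinearMap.ker ((innerSL ℝ (augment (x j))).toLinearMap ∘ₗ S.subtype) with hK
  have hmemK : ∀ j (g : S), g ∈ K j ↔ ⟪(g : EuclideanSpace ℝ (Fin (d + 1))), augment (x j)⟫_ℝ = 0 :=
    fun j g => by simp [hK, real_inner_comm]
  have htop : ⊤ ∉ (Finset.univ.erase i).image K := by
    intro h
    obtain ⟨j, hj, hjtop⟩ := Finset.mem_image.1 h
    have hji : j ≠ i := Finset.ne_of_mem_erase hj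
    set u := augment (x i)
    set v := augment (x j)
    have hu : ⟪u, u⟫_ℝ = ‖u‖ ^ 2 := real_inner_self_eq_norm_sq u
    have hv : ⟪v, v⟫_ℝ = ‖u‖ ^ 2 := by rw [real_inner_self_eq_norm_sq, hnorm j i]
    have hu0 : 0 < ‖u‖ := norm_pos_iff.2 (augment_ne_zero _)
    -- the component of `v` orthogonal to `u` lies in `S`
    have hpS : ‖u‖ ^ 2 • v - ⟪v, u⟫_ℝ • u ∈ S := by
      rw [hmemS, inner_sub_left, real_inner_smul_left, real_inner_smul_left, hu]
      ring
    have hp : (⟨_, hpS⟩ : S) ∈ K j := hjtop ▸ Submodule.mem_top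
    rw [hmemK, inner_sub_left, real_inner_smul_left, real_inner_smul_left, hv,
      real_inner_comm v u] at hp
    have hz : ‖u‖ ^ 2 • v - ⟪v, u⟫_ℝ • u = 0 := by
      rw [← inner_self_eq_zero (𝕜 := ℝ)]
      simp only [inner_sub_left, inner_sub_right, real_inner_smul_left, real_inner_smul_right, hu,
        hv, real_inner_comm v u]
      linear_combination ‖u‖ ^ 2 * hp
    have hlast := congrArg (fun p : EuclideanSpace ℝ (Fin (d + 1)) => p (Fin.last d)) hz
    simp [u, v, augment] at hlast
    have hvu : v = u := by
      rw [show ⟪v, u⟫_ℝ = ‖u‖ ^ 2 by simpa [u, v, augment] using (sub_eq_zero.1 hlast).symm,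
        ← smul_sub] at hz
      exact sub_eq_zero.1 ((smul_eq_zero.1 hz).resolve_left (by positivity))
    exact hji (hx (augment_injective hvu))
  have hne := Subspace.biUnion_ne_univ_of_top_notMem htop
  obtain ⟨g, hg⟩ := (Set.ne_univ_iff_exists_notMem _).1 hne
  refine ⟨g, (hmemS _).1 g.2, fun j hj h0 => hg ?_⟩
  simp only [Set.mem_iUnion]
  exact ⟨K j, Finset.mem_image_of_mem _ (Finset.mem_erase.2 ⟨hj, Finset.mem_univ _⟩),
    (hmemK j g).2 h0⟩

lemma reluDeriv_eq_of_mul_pos {z z₀ : ℝ} (h : 0 < z * z₀) : reluDeriv z = reluDeriv z₀ := by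
  unfold reluDeriv
  rcases mul_pos_iff.1 h with ⟨h1, h2⟩ | ⟨h1, h2⟩
  · rw [if_pos h1.le, if_pos h2.le]
  · rw [if_neg (not_le.2 h1), if_neg (not_le.2 h2)]

/-- The functions `g ↦ σ'(gᵀ x̃ᵢ) x̃ᵢ` are linearly independent modulo null sets: crossing the
hyperplane of `x̃ᵢ` away from the others changes the `i`-th function only. -/
lemma eq_zero_of_ae_sum_activeInput_eq_zero {x : Fin n → EuclideanSpace ℝ (Fin d)}
    (hx : Function.Injective x) (hnorm : ∀ i j, ‖augment (x i)‖ = ‖augment (x j)‖)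
    {v : Fin n → ℝ} (h : ∀ᵐ g ∂stdGaussian (EuclideanSpace ℝ (Fin (d + 1))),
      ∑ i, v i • activeInput (x i) g = 0) : v = 0 := by
  classical
  ext i
  have hdense := Measure.dense_of_ae h
  obtain ⟨g₀, hg0, hgj⟩ := exists_inner_eq_zero_of_ne hx hnorm i
  set u := augment (x i) with hu
  have hu0 : 0 < ⟪u, u⟫_ℝ := real_inner_self_pos.2 (augment_ne_zero _)
  have hU : ∀ σ : ℝ, σ ≠ 0 → ∃ g, ∑ i, v i • activeInput (x i) g = 0 ∧ 0 < ⟪g, u⟫_ℝ * σ ∧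
      ∀ j, j ≠ i → 0 < ⟪g, augment (x j)⟫_ℝ * ⟪g₀, augment (x j)⟫_ℝ := by
    intro σ hσ
    have hopen : IsOpen ({g : EuclideanSpace ℝ (Fin (d + 1)) | 0 < ⟪g, u⟫_ℝ * σ} ∩
        ⋂ j, {g | j ≠ i → 0 < ⟪g, augment (x j)⟫_ℝ * ⟪g₀, augment (x j)⟫_ℝ}) := by
      refine (isOpen_lt continuous_const (by fun_prop)).inter (isOpen_iInter_of_finite fun j => ?_)
      by_cases hj : j = i
      · simp [hj]
      · simp only [ne_eq, hj, not_false_eq_true, forall_const]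
        exact isOpen_lt continuous_const (by fun_prop)
    have hnonempty : ({g : EuclideanSpace ℝ (Fin (d + 1)) | 0 < ⟪g, u⟫_ℝ * σ} ∩
        ⋂ j, {g | j ≠ i → 0 < ⟪g, augment (x j)⟫_ℝ * ⟪g₀, augment (x j)⟫_ℝ}).Nonempty := by
      have hev : ∀ᶠ τ in nhdsWithin (0 : ℝ) (Set.Ioi 0), ∀ j, j ≠ i →
          0 < ⟪g₀ + (τ * σ) • u, augment (x j)⟫_ℝ * ⟪g₀, augment (x j)⟫_ℝ := by
        refine Filter.eventually_all.2 fun j => ?_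
        by_cases hj : j = i
        · simp [hj]
        · have hc : Filter.Tendsto (fun τ : ℝ => ⟪g₀ + (τ * σ) • u, augment (x j)⟫_ℝ *
              ⟪g₀, augment (x j)⟫_ℝ) (nhdsWithin 0 (Set.Ioi 0))
              (nhds (⟪g₀ + ((0 : ℝ) * σ) • u, augment (x j)⟫_ℝ * ⟪g₀, augment (x j)⟫_ℝ)) :=
            (Continuous.tendsto (by fun_prop) 0).mono_left nhdsWithin_le_nhds
          have hpos : 0 < ⟪g₀ + ((0 : ℝ) * σ) • u, augment (x j)⟫_ℝ *
              ⟪g₀, augment (x j)⟫_ℝ := by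
            rw [zero_mul, zero_smul, add_zero]
            exact mul_self_pos.2 (hgj j hj)
          filter_upwards [hc.eventually (lt_mem_nhds hpos)] with τ hτ _
          exact hτ
      obtain ⟨τ, hτ, hτ0⟩ := (hev.and self_mem_nhdsWithin).exists
      refine ⟨g₀ + (τ * σ) • u, ?_, Set.mem_iInter.2 fun j => hτ j⟩
      have hτ0 : 0 < τ := hτ0
      rw [Set.mem_ofPred_eq, inner_add_left, hg0, real_inner_smul_left, zero_add]
      have : 0 < σ ^ 2 := by positivity
      calc 0 < τ * σ ^ 2 * ⟪u, u⟫_ℝ := by positivity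
        _ = _ := by ring
    obtain ⟨g, hg, hg'⟩ := hdense.inter_open_nonempty _ hopen hnonempty
    exact ⟨g, hg', hg.1, fun j => Set.mem_iInter.1 hg.2 j⟩
  obtain ⟨g, hg, hgi, hgs⟩ := hU 1 one_ne_zero
  obtain ⟨g', hg', hgi', hgs'⟩ := hU (-1) (by norm_num)
  have hdiff : ∑ j, v j • (activeInput (x j) g - activeInput (x j) g') = 0 := by
    simp only [smul_sub, Finset.sum_sub_distrib, hg, hg', sub_zero]
  rw [Finset.sum_eq_single i] at hdiff
  · have h1 : activeInput (x i) g - activeInput (x i) g' = u := by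
      rw [activeInput, activeInput, ← hu, reluDeriv, reluDeriv, if_pos (by linarith),
        if_neg (by linarith)]
      simp
    rw [h1] at hdiff
    exact (smul_eq_zero.1 hdiff).resolve_right (augment_ne_zero _)
  · intro j _ hj
    rw [activeInput, activeInput, reluDeriv_eq_of_mul_pos (hgs j hj),
      reluDeriv_eq_of_mul_pos (hgs' j hj), sub_self, smul_zero]
  · simp

theorem posDef_ntkMatrix (hm : 0 < m) {x : Fin n → EuclideanSpace ℝ (Fin d)}
    (hx : Function.Injective x) (hnorm : ∀ i j, ‖augment (x i)‖ = ‖augment (x j)‖) :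
    (ntkMatrix m x).PosDef := by
  refine Matrix.PosDef.of_dotProduct_mulVec_pos ?_ fun v hv => ?_
  · ext i j
    simp only [Matrix.conjTranspose_apply, star_trivial, ntkMatrix_apply hm]
    simp only [real_inner_comm]
  · rw [star_trivial, dotProduct_ntkMatrix_mulVec hm]
    have hnn : 0 ≤ ∫ g, ‖∑ i, v i • activeInput (x i) g‖ ^ 2
        ∂stdGaussian (EuclideanSpace ℝ (Fin (d + 1))) :=
      integral_nonneg fun g => by positivity
    refine lt_of_le_of_ne hnn fun h0 => hv ?_
    have hint : Integrable (fun g => ‖∑ i, v i • activeInput (x i) g‖ ^ 2)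
        (stdGaussian (EuclideanSpace ℝ (Fin (d + 1)))) := by
      refine Integrable.of_bound (C := (∑ i, |v i| * ‖augment (x i)‖) ^ 2) (by fun_prop)
        (Filter.Eventually.of_forall fun g => ?_)
      rw [norm_pow, norm_norm]
      gcongr
      refine (norm_sum_le _ _).trans (Finset.sum_le_sum fun i _ => ?_)
      rw [norm_smul]
      gcongr
      exacts [le_rfl, norm_activeInput_le _ _]
    have h1 := (integral_eq_zero_iff_of_nonneg (fun g => by positivity) hint).1 h0.symm
    refine eq_zero_of_ae_sum_activeInput_eq_zero hx hnorm ?_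
    filter_upwards [h1] with g hg
    simpa using hg

/-! ### The initialization is good with high probability -/

/-- Markov's inequality for a real function. -/
lemma measure_le_of_lintegral_le {Ω : Type*} [MeasurableSpace Ω] {μ : Measure Ω} {f : Ω → ℝ}
    (hf : Measurable f) {M t q : ℝ} (ht : 0 < t)
    (h : ∫⁻ ω, ENNReal.ofReal (f ω) ∂μ ≤ ENNReal.ofReal M) (hM : M ≤ q * t) :
    μ {ω | t ≤ f ω} ≤ ENNReal.ofReal q := by
  calc μ {ω | t ≤ f ω} ≤ μ {ω | ENNReal.ofReal t ≤ ENNReal.ofReal (f ω)} :=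
        measure_mono fun ω hω => ENNReal.ofReal_le_ofReal hω
    _ ≤ (∫⁻ ω, ENNReal.ofReal (f ω) ∂μ) / ENNReal.ofReal t :=
        meas_ge_le_lintegral_div hf.ennreal_ofReal.aemeasurable (by simpa using ht) (by simp)
    _ ≤ ENNReal.ofReal M / ENNReal.ofReal t := by gcongr
    _ = ENNReal.ofReal (M / t) := (ENNReal.ofReal_div_of_pos ht).symm
    _ ≤ _ := ENNReal.ofReal_le_ofReal ((div_le_iff₀ ht).2 hM)

/-- If the empirical Gram matrix is within `c / 2` of its expectation in Frobenius norm, then it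
inherits half of the lower bound. -/
lemma le_norm_gradOp_pattern_sq {a : Fin m → ℝ} (ha : ∀ k, a k ^ 2 = 1)
    {x : Fin n → EuclideanSpace ℝ (Fin d)} {W : Fin m → EuclideanSpace ℝ (Fin (d + 1))} {c : ℝ}
    (hc : 0 < c) (hH : (ntkMatrix m x - c • (1 : Matrix (Fin n) (Fin n) ℝ)).PosSemidef)
    (hdev : ∑ i, ∑ j, (empiricalGram x W i j - ntkMatrix m x i j) ^ 2 ≤ c ^ 2 / 4)
    (v : EuclideanSpace ℝ (Fin n)) :
    c / 2 * ‖v‖ ^ 2 ≤ ‖gradOp a x (pattern x (assemble W)) v‖ ^ 2 := by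
  have h1 := hH.dotProduct_mulVec_nonneg (fun i => v i)
  have h2 : star (fun i => v i) ⬝ᵥ
      (ntkMatrix m x - c • (1 : Matrix (Fin n) (Fin n) ℝ)).mulVec (fun i => v i) =
      (∑ i, ∑ j, v i * v j * ntkMatrix m x i j) - c * ‖v‖ ^ 2 := by
    rw [Matrix.sub_mulVec, Matrix.smul_mulVec, Matrix.one_mulVec, dotProduct_sub, star_trivial,
      dotProduct_smul, EuclideanSpace.real_norm_sq_eq]
    simp only [dotProduct, Matrix.mulVec, Finset.mul_sum, smul_eq_mul]
    congr 1
    · exact Finset.sum_congr rfl fun i _ => Finset.sum_congr rfl fun j _ => by ring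
    · exact Finset.sum_congr rfl fun i _ => by ring
  have h3 : (∑ p : Fin n × Fin n, v p.1 * v p.2 *
      (empiricalGram x W p.1 p.2 - ntkMatrix m x p.1 p.2)) ^ 2 ≤ (c / 2 * ‖v‖ ^ 2) ^ 2 := by
    refine (Finset.sum_mul_sq_le_sq_mul_sq _ _ _).trans ?_
    have e1 : ∑ p : Fin n × Fin n, (v p.1 * v p.2) ^ 2 = (‖v‖ ^ 2) ^ 2 := by
      rw [EuclideanSpace.real_norm_sq_eq, pow_two (∑ i, v i ^ 2), Finset.sum_mul_sum,
        Fintype.sum_prod_type]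
      exact Finset.sum_congr rfl fun i _ => Finset.sum_congr rfl fun j _ => by ring
    rw [e1, Fintype.sum_prod_type]
    calc (‖v‖ ^ 2) ^ 2 * ∑ i, ∑ j, (empiricalGram x W i j - ntkMatrix m x i j) ^ 2
        ≤ (‖v‖ ^ 2) ^ 2 * (c ^ 2 / 4) := by gcongr
      _ = _ := by ring
  have h4 := (abs_le.1 (abs_le_of_sq_le_sq h3 (by positivity))).1
  rw [Fintype.sum_prod_type] at h4
  rw [h2] at h1
  rw [norm_gradOp_pattern_sq ha]
  have h5 : ∑ i, ∑ j, v i * v j * empiricalGram x W i j =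
      (∑ i, ∑ j, v i * v j * ntkMatrix m x i j) +
      ∑ i, ∑ j, v i * v j * (empiricalGram x W i j - ntkMatrix m x i j) := by
    simp only [← Finset.sum_add_distrib]
    exact Finset.sum_congr rfl fun i _ => Finset.sum_congr rfl fun j _ => by ring
  rw [h5]
  linarith

/-- The diagonal entries of `H` are at most `D`, hence so is any lower bound `c` of `H`. -/
lemma le_of_posSemidef_ntkMatrix_sub (hm : 0 < m) (hn : 0 < n)
    {x : Fin n → EuclideanSpace ℝ (Fin d)} {c D : ℝ} (hx : ∀ i, ‖augment (x i)‖ ^ 2 = D)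
    (hH : (ntkMatrix m x - c • (1 : Matrix (Fin n) (Fin n) ℝ)).PosSemidef) : c ≤ D := by
  have h1 : 0 ≤ (ntkMatrix m x - c • (1 : Matrix (Fin n) (Fin n) ℝ)) ⟨0, hn⟩ ⟨0, hn⟩ :=
    hH.diag_nonneg
  rw [Matrix.sub_apply, Matrix.smul_apply, Matrix.one_apply_eq, smul_eq_mul, mul_one,
    ntkMatrix_apply hm] at h1
  have h2 : ∫ g, ⟪activeInput (x ⟨0, hn⟩) g, activeInput (x ⟨0, hn⟩) g⟫_ℝ
      ∂stdGaussian (EuclideanSpace ℝ (Fin (d + 1))) ≤ ∫ _, D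
      ∂stdGaussian (EuclideanSpace ℝ (Fin (d + 1))) := by
    refine integral_mono ((memLp_inner_activeInput _ _ 1).integrable le_rfl)
      (integrable_const _) fun g => (le_abs_self _).trans
        ((abs_inner_activeInput_le _ _ _).trans_eq ?_)
    rw [← pow_two, hx]
  rw [integral_const, probReal_univ, one_smul] at h2
  linarith

/-- The bound `U` on the initial residual. The factor `1 / √δ` comes from Markov's inequality for
the squared outputs. -/
def residualScale (n : ℕ) (D Cy δ : ℝ) : ℝ := 3 * Cy * √(n * D / δ)

/-- The radius `R`: twice the bound `√(n D / m) U / (c / 4)` on the distance that a neuron can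
travel. -/
def radius (n m : ℕ) (D Cy c δ : ℝ) : ℝ := 24 * (n * D * Cy) / (c * √(m * δ))

/-- The bound `ε` on the change of the gradient: `ε²` is `D / m` times the bound `4 n m R / δ` that
Markov's inequality gives for the number of preactivations of size at most `R √D`. -/
def gradScale (n m : ℕ) (D Cy c δ : ℝ) : ℝ := √(4 * n * D * radius n m D Cy c δ / δ)

lemma norm_residual_le_residualScale {a : Fin m → ℝ} {x : Fin n → EuclideanSpace ℝ (Fin d)}
    {y : Fin n → ℝ} {w₀ : Weights m d} {D Cy δ : ℝ} (hD : 2 ≤ D) (hCy : 1 ≤ Cy) (hδ : 0 < δ)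
    (hδ1 : δ < 1) (hy : ∀ i, |y i| ≤ Cy) (h : ∑ i, net a (x i) w₀ ^ 2 ≤ 4 * n * D / δ) :
    ‖residual a x y w₀‖ ≤ residualScale n D Cy δ := by
  refine le_of_sq_le_sq ?_ (by unfold residualScale; positivity)
  rw [residualScale, mul_pow, Real.sq_sqrt (by positivity), EuclideanSpace.real_norm_sq_eq]
  have hCy2 : 1 ≤ Cy ^ 2 := one_le_pow₀ hCy
  have h1 : ∑ i, (residual a x y w₀) i ^ 2 ≤ ∑ i, (2 * net a (x i) w₀ ^ 2 + 2 * Cy ^ 2) := by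
    refine Finset.sum_le_sum fun i _ => ?_
    have hyi : y i ^ 2 ≤ Cy ^ 2 := sq_le_sq' (abs_le.1 (hy i)).1 (abs_le.1 (hy i)).2
    change (net a (x i) w₀ - y i) ^ 2 ≤ _
    -- `(f - y)² ≤ 2 f² + 2 y²`
    nlinarith [sq_nonneg (net a (x i) w₀ + y i)]
  rw [Finset.sum_add_distrib, ← Finset.mul_sum] at h1
  simp only [Finset.sum_const, Finset.card_univ, Fintype.card_fin, nsmul_eq_mul] at h1
  have h2 : (n : ℝ) * (2 * Cy ^ 2) ≤ Cy ^ 2 * (n * D / δ) := by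
    calc (n : ℝ) * (2 * Cy ^ 2) = Cy ^ 2 * (n * 2 / 1) := by ring
      _ ≤ Cy ^ 2 * (n * D / δ) := by gcongr
  have h3 : 2 * (4 * n * D / δ) ≤ 8 * Cy ^ 2 * (n * D / δ) := by
    calc 2 * (4 * n * D / δ) = 8 * 1 * (n * D / δ) := by ring
      _ ≤ _ := by gcongr
  nlinarith

section Scales

variable {D Cy c δ : ℝ}

/-- The lower bound on the width in terms of `D ≤ 2 d`, in the form in which it is used. -/
lemma width_bound (hd : 0 < d) (hn : 0 < n) (hD : D = d + 1) (hCy : 1 ≤ Cy)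
    (hc : 0 < c) (hδ : 0 < δ)
    (h : (16 * 9600 ^ 2 : ℝ) * (n ^ 6 * d ^ 4 * Cy ^ 2 / (c ^ 4 * δ ^ 3)) ≤ m) :
    9600 ^ 2 * (n ^ 4 * D ^ 4 * Cy ^ 2) ≤ c ^ 4 * δ ^ 3 * m := by
  have hd' : (1 : ℝ) ≤ d := by exact_mod_cast hd
  have hn' : (1 : ℝ) ≤ n := by exact_mod_cast hn
  rw [← mul_div_assoc, div_le_iff₀ (by positivity)] at h
  have hD4 : D ^ 4 ≤ 16 * d ^ 4 := by
    calc D ^ 4 ≤ (2 * d) ^ 4 := by rw [hD]; gcongr; linarith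
      _ = _ := by ring
  calc 9600 ^ 2 * (n ^ 4 * D ^ 4 * Cy ^ 2) ≤ 9600 ^ 2 * (n ^ 6 * (16 * d ^ 4) * Cy ^ 2) := by
        gcongr
        norm_num
    _ ≤ _ := by linarith

lemma radius_nonneg (hD : 0 ≤ D) (hCy : 0 ≤ Cy) (hc : 0 < c) : 0 ≤ radius n m D Cy c δ := by
  unfold radius
  positivity

lemma gradScale_sq (hD : 0 ≤ D) (hCy : 0 ≤ Cy) (hc : 0 < c) (hδ : 0 < δ) :
    gradScale n m D Cy c δ ^ 2 = 4 * n * D * radius n m D Cy c δ / δ := by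
  have := radius_nonneg (n := n) (m := m) (δ := δ) hD hCy hc
  exact Real.sq_sqrt (by positivity)

/-- The lower bound on the width makes the change of the gradient small against `√c`. -/
lemma gradScale_le (hm : 0 < m) (hD : 0 ≤ D) (hCy : 0 ≤ Cy) (hc : 0 < c) (hδ : 0 < δ)
    (hw : 9600 ^ 2 * (n ^ 4 * D ^ 4 * Cy ^ 2) ≤ c ^ 4 * δ ^ 3 * m) :
    10 * gradScale n m D Cy c δ ≤ √c := by
  have hm' : (0 : ℝ) < m := Nat.cast_pos.2 hm
  refine Real.le_sqrt_of_sq_le ?_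
  rw [mul_pow, gradScale_sq hD hCy hc hδ, radius]
  have hroot : 9600 * (n ^ 2 * D ^ 2 * Cy) ≤ c ^ 2 * δ * √(m * δ) := by
    refine le_of_sq_le_sq ?_ (by positivity)
    rw [mul_pow _ (√(m * δ)), Real.sq_sqrt (by positivity)]
    calc (9600 * (n ^ 2 * D ^ 2 * Cy)) ^ 2 = 9600 ^ 2 * (n ^ 4 * D ^ 4 * Cy ^ 2) := by ring
      _ ≤ _ := hw
      _ = _ := by ring
  have hs : 0 < √(m * δ) := Real.sqrt_pos.2 (by positivity)
  have e : 10 ^ 2 * (4 * n * D * (24 * (n * D * Cy) / (c * √(m * δ))) / δ) =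
      9600 * (n ^ 2 * D ^ 2 * Cy) / (c * δ * √(m * δ)) := by
    field_simp; ring
  rw [e, div_le_iff₀ (by positivity)]
  linarith

/-- The radius is large enough for the continuous induction. -/
lemma lt_radius (hm : 0 < m) (hn : 0 < n) (hD : 0 < D) (hCy : 0 < Cy) (hc : 0 < c) (hδ : 0 < δ) :
    √(n * D / m) * residualScale n D Cy δ / (c / 4) < radius n m D Cy c δ := by
  have hm' : (0 : ℝ) < m := Nat.cast_pos.2 hm
  have hn' : (0 : ℝ) < n := Nat.cast_pos.2 hn
  have hs : 0 < √(m * δ) := Real.sqrt_pos.2 (by positivity)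
  have h1 : √(n * D / m) * √(n * D / δ) = n * D / √(m * δ) := by
    rw [← Real.sqrt_mul (by positivity), div_mul_div_comm, Real.sqrt_div (by positivity),
      Real.sqrt_mul_self (by positivity)]
  have h2 : √(n * D / m) * residualScale n D Cy δ / (c / 4) =
      12 * (n * D * Cy) / (c * √(m * δ)) := by
    calc _ = (√(n * D / m) * √(n * D / δ)) * (12 * Cy / c) := by
          unfold residualScale; field_simp; ring
      _ = _ := by rw [h1]; field_simp
  rw [h2, radius]
  gcongr
  norm_num

lemma rpow_pow_four {X p : ℝ} (hX : 0 ≤ X) {k : ℕ} (h : p * 4 = k) : (X ^ p) ^ 4 = X ^ k := by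
  rw [← Real.rpow_natCast (X ^ p) 4, ← Real.rpow_mul hX, ← Real.rpow_natCast X k]
  norm_num [h]

/-- The error of the deterministic analysis in terms of the parameters. Fourth powers of both sides
are rational expressions. -/
lemma error_le (hm : 0 < m) (hd : 0 < d) (hD : D = d + 1) (hCy : 1 ≤ Cy) (hc : 0 < c)
    (hδ : 0 < δ) (hδ1 : δ < 1) :
    14 * (n * D * (gradScale n m D Cy c δ * residualScale n D Cy δ) / c ^ 2) ≤
      2338 * (((d : ℝ) * n) ^ (5 / 2 : ℝ) * Cy ^ (3 / 2 : ℝ) /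
        (c ^ (5 / 2 : ℝ) * δ ^ (3 / 2 : ℝ) * (m : ℝ) ^ (1 / 4 : ℝ))) := by
  have hm' : (0 : ℝ) < m := Nat.cast_pos.2 hm
  have hd' : (1 : ℝ) ≤ d := by exact_mod_cast hd
  have hD0 : 0 < D := by rw [hD]; positivity
  have hCy0 : 0 < Cy := by linarith
  have key : n * D * (gradScale n m D Cy c δ * residualScale n D Cy δ) / c ^ 2 ≤
      167 * (((d : ℝ) * n) ^ (5 / 2 : ℝ) * Cy ^ (3 / 2 : ℝ) /
        (c ^ (5 / 2 : ℝ) * δ ^ (3 / 2 : ℝ) * (m : ℝ) ^ (1 / 4 : ℝ))) := by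
    refine le_of_pow_le_pow_left₀ (n := 4) (by norm_num) (by positivity) ?_
    have hε4 : gradScale n m D Cy c δ ^ 4 =
        9216 * (n ^ 4 * D ^ 4 * Cy ^ 2) / (c ^ 2 * δ ^ 3 * m) := by
      rw [show 4 = 2 * 2 from rfl, pow_mul, gradScale_sq hD0.le hCy0.le hc hδ, radius, div_pow,
        mul_pow, div_pow, mul_pow c, Real.sq_sqrt (by positivity)]
      field_simp
      ring
    have hU4 : residualScale n D Cy δ ^ 4 = 81 * (n ^ 2 * D ^ 2 * Cy ^ 4) / δ ^ 2 := by
      rw [residualScale, mul_pow, show √(n * D / δ) ^ 4 = (√(n * D / δ) ^ 2) ^ 2 by ring,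
        Real.sq_sqrt (by positivity)]
      field_simp
      ring
    have hD10 : D ^ 10 ≤ 1024 * d ^ 10 := by
      calc D ^ 10 ≤ (2 * d) ^ 10 := by rw [hD]; gcongr; linarith
        _ = _ := by ring
    have hl : (n * D * (gradScale n m D Cy c δ * residualScale n D Cy δ) / c ^ 2) ^ 4 =
        746496 * (n ^ 10 * D ^ 10 * Cy ^ 6) / (c ^ 10 * δ ^ 5 * m) := by
      rw [div_pow, mul_pow, mul_pow, mul_pow (gradScale n m D Cy c δ), hε4, hU4]
      field_simp
      ring
    have hr : (167 * (((d : ℝ) * n) ^ (5 / 2 : ℝ) * Cy ^ (3 / 2 : ℝ) /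
        (c ^ (5 / 2 : ℝ) * δ ^ (3 / 2 : ℝ) * (m : ℝ) ^ (1 / 4 : ℝ)))) ^ 4 =
        167 ^ 4 * (n ^ 10 * d ^ 10 * Cy ^ 6) / (c ^ 10 * δ ^ 6 * m) := by
      rw [mul_pow, div_pow, mul_pow, mul_pow, mul_pow,
        rpow_pow_four (k := 10) (by positivity) (by norm_num),
        rpow_pow_four (k := 6) hCy0.le (by norm_num),
        rpow_pow_four (k := 10) hc.le (by norm_num),
        rpow_pow_four (k := 6) hδ.le (by norm_num),
        rpow_pow_four (k := 1) hm'.le (by norm_num)]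
      ring
    rw [hl, hr]
    have hδ6 : δ ^ 6 ≤ δ ^ 5 := pow_le_pow_of_le_one hδ.le hδ1.le (by norm_num)
    have hpos : 0 ≤ (n : ℝ) ^ 10 * d ^ 10 * Cy ^ 6 := by positivity
    refine div_le_div₀ (by positivity) ?_ (by positivity) (by gcongr)
    calc 746496 * (n ^ 10 * D ^ 10 * Cy ^ 6)
        ≤ 746496 * (n ^ 10 * (1024 * d ^ 10) * Cy ^ 6) := by gcongr
      -- `746496 * 1024 ≤ 167 ^ 4`
      _ ≤ _ := by linarith
  linarith

end Scales

/-- The initialization is good outside an event of probability at most `3δ/4`: Markov's inequality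
applied to the squared network outputs, to the number of small preactivations, and to the squared
deviation of the Gram matrix. -/
theorem initMeasure_not_goodInit_le {x : Fin n → EuclideanSpace ℝ (Fin d)} {y : Fin n → ℝ}
    {D Cy c δ : ℝ} (hd : 0 < d) (hm : 0 < m) (hn : 0 < n) (hD : D = d + 1)
    (hx : ∀ i, ‖augment (x i)‖ ^ 2 = D) (hCy : 1 ≤ Cy) (hy : ∀ i, |y i| ≤ Cy) (hc : 0 < c)
    (hδ : 0 < δ) (hδ1 : δ < 1)
    (hH : (ntkMatrix m x - c • (1 : Matrix (Fin n) (Fin n) ℝ)).PosSemidef)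
    (hw : 9600 ^ 2 * (n ^ 4 * D ^ 4 * Cy ^ 2) ≤ c ^ 4 * δ ^ 3 * m) :
    initMeasure m d {p | ¬ GoodInit p.2 x y (assemble p.1) D c (residualScale n D Cy δ)
      (radius n m D Cy c δ) (gradScale n m D Cy c δ)} ≤ ENNReal.ofReal (3 / 4 * δ) := by
  have hm' : (0 : ℝ) < m := Nat.cast_pos.2 hm
  have hn' : (1 : ℝ) ≤ n := by exact_mod_cast hn
  have hd' : (1 : ℝ) ≤ d := by exact_mod_cast hd
  have hD2 : 2 ≤ D := by linarith
  have hD0 : 0 < D := by linarith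
  have hCy0 : 0 < Cy := by linarith
  set R := radius n m D Cy c δ with hR
  have hRpos : 0 < R := by rw [hR, radius]; positivity
  set A := {p : (Fin m → EuclideanSpace ℝ (Fin (d + 1))) × (Fin m → ℝ) |
    4 * n * D / δ ≤ ∑ i, net p.2 (x i) (assemble p.1) ^ 2} with hA
  set B := {p : (Fin m → EuclideanSpace ℝ (Fin (d + 1))) × (Fin m → ℝ) |
    4 * n * m * R / δ ≤ nearKinkCount x (assemble p.1) (R * √D)} with hB
  set C := {p : (Fin m → EuclideanSpace ℝ (Fin (d + 1))) × (Fin m → ℝ) |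
    c ^ 2 / 4 ≤ ∑ i, ∑ j, (empiricalGram x p.1 i j - ntkMatrix m x i j) ^ 2} with hC
  set N := {p : (Fin m → EuclideanSpace ℝ (Fin (d + 1))) × (Fin m → ℝ) |
    ¬ ∀ k, p.2 k ^ 2 = 1} with hN
  have hsub : {p | ¬ GoodInit p.2 x y (assemble p.1) D c (residualScale n D Cy δ) R
      (gradScale n m D Cy c δ)} ⊆ A ∪ B ∪ C ∪ N := by
    intro p hp
    by_contra hcon
    simp only [Set.mem_union, not_or, hA, hB, hC, hN, Set.mem_ofPred_eq, not_le, not_not] at hcon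
    obtain ⟨⟨⟨h1, h2⟩, h3⟩, h4⟩ := hcon
    refine hp
      { m_pos := hm
        c_pos := hc
        D_nonneg := hD0.le
        ε_nonneg := Real.sqrt_nonneg _
        sign_sq := h4
        norm_augment_sq := hx
        ε_le := gradScale_le hm hD0.le hCy0.le hc hδ hw
        lt_R := lt_radius hm hn hD0 hCy0 hc hδ
        norm_residual_le := norm_residual_le_residualScale hD2 hCy hδ hδ1 hy h1.le
        count_le := ?_
        le_norm_gradOp := le_norm_gradOp_pattern_sq h4 hc hH h3.le }
    rw [gradScale_sq hD0.le hCy0.le hc hδ, div_le_iff₀ hm']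
    calc D * nearKinkCount x (assemble p.1) (R * √D) ≤ D * (4 * n * m * R / δ) := by gcongr
      _ = _ := by ring
  have hAle : initMeasure m d A ≤ ENNReal.ofReal (δ / 4) := by
    refine measure_le_of_lintegral_le (M := n * D)
      (Finset.measurable_sum _ fun i _ => (measurable_net (x i)).pow_const 2) (by positivity) ?_
      (le_of_eq (by field_simp))
    simp only [ENNReal.ofReal_sum_of_nonneg
      fun i (_ : i ∈ Finset.univ) => sq_nonneg (net _ (x i) _)]
    rw [lintegral_finsetSum _ fun i _ => ((measurable_net (x i)).pow_const 2).ennreal_ofReal]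
    calc _ ≤ ∑ i : Fin n, ENNReal.ofReal D := by
          gcongr with i
          rw [← hx i]
          exact lintegral_net_sq_le (x i)
      _ = ENNReal.ofReal (n * D) := by
          rw [ENNReal.ofReal_mul (by positivity)]
          simp
  have hBle : initMeasure m d B ≤ ENNReal.ofReal (δ / 4) :=
    measure_le_of_lintegral_le (M := n * m * R) (measurable_nearKinkCount x _) (by positivity)
      (lintegral_nearKinkCount_le x hx) (le_of_eq (by field_simp))
  have hCle : initMeasure m d C ≤ ENNReal.ofReal (δ / 4) := by
    have hmeas : ∀ i j, Measurable fun p : (Fin m → EuclideanSpace ℝ (Fin (d + 1))) × (Fin m → ℝ) =>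
        (empiricalGram x p.1 i j - ntkMatrix m x i j) ^ 2 := fun i j =>
      (((measurable_empiricalGram x i j).comp measurable_fst).sub_const _).pow_const 2
    refine measure_le_of_lintegral_le (M := n * (n * (D ^ 2 / m)))
      (Finset.measurable_sum _ fun i _ => Finset.measurable_sum _ fun j _ => hmeas i j)
      (by positivity) ?_ ?_
    · have hsum : ∀ p : (Fin m → EuclideanSpace ℝ (Fin (d + 1))) × (Fin m → ℝ),
          ENNReal.ofReal (∑ i, ∑ j, (empiricalGram x p.1 i j - ntkMatrix m x i j) ^ 2) =
          ∑ i, ∑ j, ENNReal.ofReal ((empiricalGram x p.1 i j - ntkMatrix m x i j) ^ 2) := by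
        intro p
        rw [ENNReal.ofReal_sum_of_nonneg
          fun i _ => Finset.sum_nonneg fun j _ => sq_nonneg _]
        exact Finset.sum_congr rfl fun i _ =>
          ENNReal.ofReal_sum_of_nonneg fun j _ => sq_nonneg _
      simp only [hsum]
      rw [lintegral_finsetSum _ fun i _ =>
        Finset.measurable_sum _ fun j _ => (hmeas i j).ennreal_ofReal]
      simp only [lintegral_finsetSum _ fun j _ => (hmeas _ j).ennreal_ofReal]
      calc _ ≤ ∑ i : Fin n, ∑ j : Fin n, ENNReal.ofReal (D ^ 2 / m) :=
            Finset.sum_le_sum fun i _ => Finset.sum_le_sum fun j _ =>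
              lintegral_sq_empiricalGram_sub_le hm hx i j
        _ = _ := by
            rw [ENNReal.ofReal_mul (by positivity), ENNReal.ofReal_mul (by positivity)]
            simp
    · -- `c ≤ D` and `δ ≤ 1` reduce the requirement `16 n² D² ≤ c² δ m` to the bound on the width
      have hcD : c ≤ D := le_of_posSemidef_ntkMatrix_sub hm hn hx hH
      have h1 : c ^ 2 * δ ^ 2 * (16 * (n ^ 2 * D ^ 2)) ≤ c ^ 2 * δ ^ 2 * (c ^ 2 * δ * m) := by
        calc c ^ 2 * δ ^ 2 * (16 * (n ^ 2 * D ^ 2)) ≤ D ^ 2 * 1 ^ 2 * (16 * (n ^ 2 * D ^ 2)) := by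
              gcongr
          _ = 16 * (n ^ 2 * D ^ 4 * 1 ^ 2) := by ring
          _ ≤ 9600 ^ 2 * (n ^ 4 * D ^ 4 * Cy ^ 2) := by
              gcongr <;> norm_num
          _ ≤ _ := hw
          _ = _ := by ring
      have h2 := le_of_mul_le_mul_left h1 (by positivity)
      rw [← mul_assoc, ← mul_div_assoc, div_le_iff₀ hm']
      linarith
  have hNle : initMeasure m d N = 0 := ae_initMeasure_sq_eq_one
  calc _ ≤ initMeasure m d (A ∪ B ∪ C ∪ N) := measure_mono hsub
    _ ≤ initMeasure m d A + initMeasure m d B + initMeasure m d C + initMeasure m d N := by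
        refine (measure_union_le _ _).trans (add_le_add_left ?_ _)
        refine (measure_union_le _ _).trans (add_le_add_left ?_ _)
        exact measure_union_le _ _
    _ ≤ ENNReal.ofReal (δ / 4) + ENNReal.ofReal (δ / 4) + ENNReal.ofReal (δ / 4) + 0 := by
        rw [hNle]; gcongr
    _ = ENNReal.ofReal (3 / 4 * δ) := by
        rw [add_zero, ← ENNReal.ofReal_add (by positivity) (by positivity),
          ← ENNReal.ofReal_add (by positivity) (by positivity)]
        congr 1
        ring

/-- Without data the flow is constant, and the initial weights are the minimum-norm interpolant. -/
lemma exists_isMinNormInterpolant_of_isEmpty (a : Fin m → ℝ) (x : Fin 0 → EuclideanSpace ℝ (Fin d))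
    (y : Fin 0 → ℝ) (w₀ : Weights m d) :
    ∃ wL, IsMinNormInterpolant a w₀ x y wL ∧
      ∀ w, IsGradientFlow a x y w₀ w → ∀ t, 0 ≤ t → w t = wL := by
  refine ⟨w₀, ⟨fun i => i.elim0, fun w _ => by simp⟩, fun w hw t ht => ?_⟩
  have h := norm_sub_le_of_deriv_le_exp (K := 0) (μ := 1) ht le_rfl one_pos (hw.2.1 t ht) (by
    filter_upwards [hw.ae_hasDerivAt ht] with τ hτ hmem
    obtain ⟨s, -, hd, -⟩ := hτ hmem
    refine ⟨_, hd, ?_⟩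
    simp [gradOp, synthesis_apply])
  rw [hw.1, zero_div] at h
  exact sub_eq_zero.1 (norm_le_zero_iff.1 h)

end ShallowReLU

end

theorem mainTheorem2 :
    ∃ C₁ C₂ : ℝ, 0 < C₁ ∧ 0 < C₂ ∧
      ∀ (d n m : ℕ) (x : Fin n → EuclideanSpace ℝ (Fin d)) (y : Fin n → ℝ) (Cy : ℝ),
        0 < d → 0 < m → 1 ≤ Cy →
        (∀ i, |y i| ≤ Cy) → (∀ i, ‖x i‖ = Real.sqrt d) →
        (∀ i j, i ≠ j → LinearIndependent ℝ ![x i, x j]) →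
        (ShallowReLU.ntkMatrix m x).PosDef ∧
        ∀ c δ : ℝ, 0 < c →
          (ShallowReLU.ntkMatrix m x - c • (1 : Matrix (Fin n) (Fin n) ℝ)).PosSemidef →
          0 < δ → δ < 1 →
          C₁ * ((n : ℝ) ^ 6 * (d : ℝ) ^ 4 * Cy ^ 2 / (c ^ 4 * δ ^ 3)) ≤ (m : ℝ) →
          ShallowReLU.initMeasure m d {p |
            ¬ ∃ wL : ShallowReLU.Weights m d,
              ShallowReLU.IsMinNormInterpolant p.2 (ShallowReLU.assemble p.1) x y wL ∧
              ∀ w : ℝ → ShallowReLU.Weights m d,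
                ShallowReLU.IsGradientFlow p.2 x y (ShallowReLU.assemble p.1) w →
                ∀ t : ℝ, 0 ≤ t →
                  ‖w t - wL‖ ≤ Real.exp (-(c * t / 2)) * ‖w 0 - wL‖ +
                    C₂ * (((d : ℝ) * n) ^ (5 / 2 : ℝ) * Cy ^ (3 / 2 : ℝ) /
                      (c ^ (5 / 2 : ℝ) * δ ^ (3 / 2 : ℝ) * (m : ℝ) ^ (1 / 4 : ℝ)))}
            < ENNReal.ofReal δ := by
  refine ⟨16 * 9600 ^ 2, 2338, by norm_num, by norm_num, ?_⟩
  intro d n m x y Cy hd hm hCy hy hnorm hind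
  have hinj : Function.Injective x := by
    intro i j hij
    by_contra hne
    have := (hind i j hne).injective.ne (show (0 : Fin 2) ≠ 1 by decide)
    exact this (by simpa using hij)
  have hx : ∀ i, ‖ShallowReLU.augment (x i)‖ ^ 2 = (d : ℝ) + 1 := fun i =>
    ShallowReLU.norm_augment_sq_eq (hnorm i)
  have hxx : ∀ i j, ‖ShallowReLU.augment (x i)‖ = ‖ShallowReLU.augment (x j)‖ := fun i j => by
    rw [← sq_eq_sq₀ (norm_nonneg _) (norm_nonneg _), hx, hx]
  refine ⟨ShallowReLU.posDef_ntkMatrix hm hinj hxx, ?_⟩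
  intro c δ hc hH hδ hδ1 hw
  rcases Nat.eq_zero_or_pos n with rfl | hn
  · refine lt_of_eq_of_lt ?_ (ENNReal.ofReal_pos.2 hδ)
    convert measure_empty (μ := ShallowReLU.initMeasure m d)
    refine Set.eq_empty_of_forall_notMem fun p hp => hp ?_
    obtain ⟨wL, hwL, hflow⟩ :=
      ShallowReLU.exists_isMinNormInterpolant_of_isEmpty p.2 x y (ShallowReLU.assemble p.1)
    refine ⟨wL, hwL, fun w hw t ht => ?_⟩
    rw [hflow w hw t ht, hflow w hw 0 le_rfl, sub_self, norm_zero]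
    have : 0 < Cy := by linarith
    positivity
  · have hwidth := ShallowReLU.width_bound (D := (d : ℝ) + 1) hd hn rfl hCy hc hδ hw
    refine lt_of_le_of_lt (measure_mono ?_) ((ShallowReLU.initMeasure_not_goodInit_le
      hd hm hn rfl hx hCy hy hc hδ hδ1 hH hwidth).trans_lt
        ((ENNReal.ofReal_lt_ofReal_iff hδ).2 (by linarith)))
    intro p hp hgood
    refine hp ?_
    have hn' : (1 : ℝ) ≤ n := by exact_mod_cast hn
    have hcD := ShallowReLU.le_of_posSemidef_ntkMatrix_sub hm hn hx hH
    obtain ⟨wL, hwL, hflow⟩ := hgood.exists_isMinNormInterpolant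
      (hcD.trans (le_mul_of_one_le_left (by positivity) hn'))
    refine ⟨wL, hwL, fun w hw t ht => (hflow w hw t ht).trans
      (add_le_add le_rfl (ShallowReLU.error_le hm hd rfl hCy hc hδ hδ1))⟩
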